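/- Let $M$ be a nonempty (Hausdorff) smooth manifold of odd dimension $2m+1\ge 3$ with a contact form $\eta$, i.e. a smooth $1$-form such that $\eta\wedge(d\eta)^m\neq 0$ everywhere, and let $D=\ker\eta$. Let $(\phi,\xi,\eta,g)$ be an almost contact metric structure on $M$: $\phi$ is a smooth $(1,1)$-tensor field, $\xi$ a smooth vector field and $g$ a smooth Riemannian metric with $$\phi^2=-I+\eta\otimes\xi,\qquad \eta(\xi)=1,\qquad g(\phi X,\phi Y)=g(X,Y)-\eta(X)\eta(Y).$$ Let $\nabla$ be the Levi-Civita connection of $g$ and $\Phi(X,Y)=g(X,\phi Y)$. For $p\in M$ let $\mathcal C(T_pM)$ be the space of trilinear forms $a$ on $T_pM$ with $$a(x,y,z)=-a(x,z,y)=-a(x,\phi y,\phi z)+\eta(y)a(x,\xi,z)+\eta(z)a(x,y,\xi),$$ and let $C_9$ and $C_{10}$ be the subspaces of those $a\in\mathcal C(T_pM)$ that satisfy, for all $x,y,z$, $$C_9:\ a(x,y,z)=\eta(z)a(y,x,\xi)+\eta(y)a(\phi x,\phi z,\xi),$$ $$C_{10}:\ a(x,y,z)=-\eta(z)a(y,x,\xi)+\eta(y)a(\phi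 x,\phi z,\xi).$$ Suppose that the structure is of Chinea–González class $C_9\oplus C_{10}$, i.e. the trilinear form $(x,y,z)\mapsto(\nabla_x\Phi)(y,z)$ on $T_pM$ lies in $C_9+C_{10}$ for every $p\in M$. Then: 1. $\dim M=4n+1$ for some integer $n\ge 1$. 2. If there exist $p\in M$ and $c\in\mathbb R$ such that the sectional curvature satisfies $K_p(\pi)=c$ for every $2$-plane $\pi\subset D_p$, then $\dim M=5$. -/

import Mathlib

open Bundle VectorField
open scoped Manifold ContDiff InnerProductSpace

noncomputable section

set_option linter.unusedSectionVars false

namespace ContactGeometry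

/-! ### Vector fields, one-forms and endomorphism fields -/

/-- The (not necessarily continuous) vector field `X` is differentiable at `p`. -/
abbrev DiffAt {d : ℕ} {M : Type*} [TopologicalSpace M]
    [ChartedSpace (EuclideanSpace ℝ (Fin d)) M] [IsManifold (𝓡 d) ∞ M]
    (X : Π x : M, TangentSpace (𝓡 d) x) (p : M) : Prop :=
  MDifferentiableAt (𝓡 d) ((𝓡 d).prod 𝓘(ℝ, EuclideanSpace ℝ (Fin d)))
    (fun x => TotalSpace.mk' (EuclideanSpace ℝ (Fin d)) x (X x)) p

section Fields

variable (d : ℕ) (M : Type*) [TopologicalSpace M] [ChartedSpace (EuclideanSpace ℝ (Fin d)) M]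
  [IsManifold (𝓡 d) ∞ M]

/-- Smooth vector fields on a `d`-dimensional manifold. -/
abbrev SmoothVectorField : Type _ :=
  ContMDiffSection (𝓡 d) (EuclideanSpace ℝ (Fin d)) ∞ (fun x : M => TangentSpace (𝓡 d) x)

/-- Smooth one-forms. -/
abbrev SmoothOneForm : Type _ :=
  ContMDiffSection (𝓡 d) (EuclideanSpace ℝ (Fin d) →L[ℝ] ℝ) ∞
    (fun x : M => TangentSpace (𝓡 d) x →L[ℝ] Trivial M ℝ x)

/-- Smooth tensor fields of type `(1,1)`. -/
abbrev SmoothEndomorphismField : Type _ :=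
  ContMDiffSection (𝓡 d) (EuclideanSpace ℝ (Fin d) →L[ℝ] EuclideanSpace ℝ (Fin d)) ∞
    (fun x : M => TangentSpace (𝓡 d) x →L[ℝ] TangentSpace (𝓡 d) x)

end Fields

section Exterior

variable {d : ℕ} {M : Type*} [TopologicalSpace M] [ChartedSpace (EuclideanSpace ℝ (Fin d)) M]
  [IsManifold (𝓡 d) ∞ M]

/-- The value of a one-form at a point, as a linear functional on the tangent space. -/
def SmoothOneForm.at (η : SmoothOneForm d M) (p : M) : TangentSpace (𝓡 d) p →L[ℝ] ℝ := η p

lemma SmoothOneForm.mdifferentiableAt_apply (η : SmoothOneForm d M)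
    {X : Π x : M, TangentSpace (𝓡 d) x} {p : M} (hX : DiffAt X p) :
    MDifferentiableAt (𝓡 d) 𝓘(ℝ, ℝ) (fun x => η.at x (X x)) p := by
  have h := MDifferentiableAt.clm_bundle_apply (b := fun x : M => x)
    ((η.contMDiff.mdifferentiable (by simp)) p) hX
  simp only [mdifferentiableAt_totalSpace] at h
  exact h.2

/-- `X(η(Y)) - Y(η(X)) - η([X,Y])` -/
def extDerivAux (η : SmoothOneForm d M) (X Y : Π x : M, TangentSpace (𝓡 d) x) (p : M) : ℝ :=
  mvfderiv (𝓡 d) (fun x => η.at x (Y x)) p (X p) - mvfderiv (𝓡 d) (fun x => η.at x (X x)) p (Y p)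
    - η.at p (mlieBracket (𝓡 d) X Y p)

lemma extDerivAux_swap (η : SmoothOneForm d M) (X Y : Π x : M, TangentSpace (𝓡 d) x) (p : M) :
    extDerivAux η X Y p = - extDerivAux η Y X p := by
  simp only [extDerivAux]
  rw [mlieBracket_swap_apply, map_neg]
  ring

lemma extDerivAux_tensorial₁ (η : SmoothOneForm d M) (p : M)
    (Y : Π x : M, TangentSpace (𝓡 d) x) :
    TensorialAt (𝓡 d) (EuclideanSpace ℝ (Fin d)) (fun X => extDerivAux η X Y p) p where
  smul {f X} hf hX := by
    have h := mvfderiv_fun_mul hf (η.mdifferentiableAt_apply hX)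
    simp [extDerivAux, mlieBracket_smul_left hf hX, h]
    ring
  add {X X'} hX hX' := by
    have h := mvfderiv_fun_add (η.mdifferentiableAt_apply hX) (η.mdifferentiableAt_apply hX')
    simp [extDerivAux, mlieBracket_add_left hX hX', h]
    ring

lemma extDerivAux_tensorial₂ (η : SmoothOneForm d M) (p : M)
    (X : Π x : M, TangentSpace (𝓡 d) x) :
    TensorialAt (𝓡 d) (EuclideanSpace ℝ (Fin d)) (fun Y => extDerivAux η X Y p) p where
  smul hf hY := by
    rw [extDerivAux_swap, (extDerivAux_tensorial₁ η p X).smul hf hY, extDerivAux_swap η X]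
    simp
  add hY hY' := by
    rw [extDerivAux_swap, (extDerivAux_tensorial₁ η p X).add hY hY', extDerivAux_swap η X,
      extDerivAux_swap η X]
    ring

/-- The exterior derivative of a one-form, as a bilinear form on each tangent space:
`dη(X,Y) = X(η(Y)) - Y(η(X)) - η([X,Y])`. -/
def SmoothOneForm.extDeriv (η : SmoothOneForm d M) (p : M) :
    TangentSpace (𝓡 d) p →L[ℝ] TangentSpace (𝓡 d) p →L[ℝ] ℝ :=
  TensorialAt.mkHom₂ (fun X Y => extDerivAux η X Y p) p
    (fun Y _ => extDerivAux_tensorial₁ η p Y) (fun X _ => extDerivAux_tensorial₂ η p X)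

theorem SmoothOneForm.extDeriv_apply (η : SmoothOneForm d M) {p : M}
    {X Y : Π x : M, TangentSpace (𝓡 d) x} (hX : DiffAt X p) (hY : DiffAt Y p) :
    η.extDeriv p (X p) (Y p) =
      mvfderiv (𝓡 d) (fun x => η.at x (Y x)) p (X p)
        - mvfderiv (𝓡 d) (fun x => η.at x (X x)) p (Y p)
        - η.at p (mlieBracket (𝓡 d) X Y p) :=
  TensorialAt.mkHom₂_apply _ _ hX hY

end Exterior

section Contact

variable {m : ℕ} {M : Type*} [TopologicalSpace M]
  [ChartedSpace (EuclideanSpace ℝ (Fin (2 * m + 1))) M] [IsManifold (𝓡 (2 * m + 1)) ∞ M]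

/-- The value of the `(2m+1)`-form `η ∧ (dη)^m` on `2m+1` tangent vectors. -/
def contactVolume (η : SmoothOneForm (2 * m + 1) M) (p : M)
    (v : Fin (2 * m + 1) → TangentSpace (𝓡 (2 * m + 1)) p) : ℝ :=
  (1 / 2 ^ m : ℝ) * ∑ σ : Equiv.Perm (Fin (2 * m + 1)), ((Equiv.Perm.sign σ : ℤ) : ℝ) *
    (η.at p (v (σ ⟨0, by omega⟩)) *
      ∏ i : Fin m, η.extDeriv p (v (σ ⟨2 * i + 1, by omega⟩)) (v (σ ⟨2 * i + 2, by omega⟩)))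

/-- `η` is a contact form: `η ∧ (dη)^m ≠ 0` everywhere on the `(2m+1)`-dimensional manifold. -/
def IsContactForm (η : SmoothOneForm (2 * m + 1) M) : Prop :=
  ∀ p : M, ∃ v, contactVolume η p v ≠ 0

end Contact

section Riemannian

variable {d : ℕ} {M : Type*} [TopologicalSpace M] [ChartedSpace (EuclideanSpace ℝ (Fin d)) M]
  [IsManifold (𝓡 d) ∞ M] [RiemannianBundle (fun x : M => TangentSpace (𝓡 d) x)]

/-- `(φ, ξ, η, g)` is an almost contact metric structure, where `g` is the Riemannian metric
carried by `M`. -/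
structure IsAlmostContactMetric (φ : SmoothEndomorphismField d M) (ξ : SmoothVectorField d M)
    (η : SmoothOneForm d M) : Prop where
  phi_sq : ∀ (p : M) (v : TangentSpace (𝓡 d) p), φ p (φ p v) = - v + η.at p v • ξ p
  eta_xi : ∀ p : M, η.at p (ξ p) = 1
  metric : ∀ (p : M) (v w : TangentSpace (𝓡 d) p),
    ⟪φ p v, φ p w⟫_ℝ = ⟪v, w⟫_ℝ - η.at p v * η.at p w

variable [IsContMDiffRiemannianBundle (𝓡 d) ∞ (EuclideanSpace ℝ (Fin d))
    (fun x : M => TangentSpace (𝓡 d) x)]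

instance instIsContMDiffRiemannianBundleOne : IsContMDiffRiemannianBundle (𝓡 d) 1
    (EuclideanSpace ℝ (Fin d)) (fun x : M => TangentSpace (𝓡 d) x) :=
  IsContMDiffRiemannianBundle.of_le (n := ∞) (by simp)

/-- `∇` is the Levi-Civita connection of the Riemannian metric: it is torsion-free and metric. -/
def IsLeviCivita (nabla : CovariantDerivative (𝓡 d) (EuclideanSpace ℝ (Fin d))
    (fun x : M => TangentSpace (𝓡 d) x)) : Prop :=
  nabla.torsion = 0 ∧ nabla.IsMetricCompatible

/-! ### The covariant derivative of the fundamental two-form -/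

/-- The fundamental two-form `Φ(v,w) = g(v, φ w)`. -/
def fundamentalForm (φ : SmoothEndomorphismField d M) (p : M) (v w : TangentSpace (𝓡 d) p) : ℝ :=
  ⟪v, φ p w⟫_ℝ

lemma diffAt_endomorphism_apply (φ : SmoothEndomorphismField d M)
    {X : Π x : M, TangentSpace (𝓡 d) x} {p : M} (hX : DiffAt X p) :
    DiffAt (fun x => φ x (X x)) p :=
  MDifferentiableAt.clm_bundle_apply (b := fun x : M => x)
    ((φ.contMDiff.mdifferentiable (by simp)) p) hX

lemma mdifferentiableAt_fundamentalForm (φ : SmoothEndomorphismField d M)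
    {Y Z : Π x : M, TangentSpace (𝓡 d) x} {p : M} (hY : DiffAt Y p) (hZ : DiffAt Z p) :
    MDifferentiableAt (𝓡 d) 𝓘(ℝ, ℝ) (fun x => fundamentalForm φ x (Y x) (Z x)) p :=
  MDifferentiableAt.inner_bundle hY (diffAt_endomorphism_apply φ hZ)

/-- `X ↦ X(Φ(Y,Z)) - Φ(∇_X Y, Z) - Φ(Y, ∇_X Z)` -/
def nablaPhiAux (nabla : CovariantDerivative (𝓡 d) (EuclideanSpace ℝ (Fin d))
      (fun x : M => TangentSpace (𝓡 d) x))
    (φ : SmoothEndomorphismField d M) (p : M) (Y Z : Π x : M, TangentSpace (𝓡 d) x) :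
    TangentSpace (𝓡 d) p →L[ℝ] ℝ :=
  mvfderiv (𝓡 d) (fun x => fundamentalForm φ x (Y x) (Z x)) p
    - innerSL ℝ (φ p (Z p)) ∘L nabla Y p - innerSL ℝ (Y p) ∘L φ p ∘L nabla Z p

lemma nablaPhiAux_apply (nabla : CovariantDerivative (𝓡 d) (EuclideanSpace ℝ (Fin d))
      (fun x : M => TangentSpace (𝓡 d) x))
    (φ : SmoothEndomorphismField d M) (p : M) (Y Z : Π x : M, TangentSpace (𝓡 d) x)
    (u : TangentSpace (𝓡 d) p) :
    nablaPhiAux nabla φ p Y Z u =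
      mvfderiv (𝓡 d) (fun x => fundamentalForm φ x (Y x) (Z x)) p u
        - fundamentalForm φ p (nabla Y p u) (Z p) - fundamentalForm φ p (Y p) (nabla Z p u) := by
  simp only [fundamentalForm]
  rw [real_inner_comm (φ p (Z p))]
  rfl

lemma nablaPhiAux_tensorial₁ (nabla : CovariantDerivative (𝓡 d) (EuclideanSpace ℝ (Fin d))
      (fun x : M => TangentSpace (𝓡 d) x))
    (φ : SmoothEndomorphismField d M) (p : M) (Z : Π x : M, TangentSpace (𝓡 d) x)
    (hZ : DiffAt Z p) :
    TensorialAt (𝓡 d) (EuclideanSpace ℝ (Fin d)) (fun Y => nablaPhiAux nabla φ p Y Z) p where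
  smul {f Y} hf hY := by
    ext u
    have h := mvfderiv_fun_mul hf (mdifferentiableAt_fundamentalForm φ hY hZ)
    have e : (fun x => fundamentalForm φ x ((f • Y) x) (Z x)) =
        fun x => f x * fundamentalForm φ x (Y x) (Z x) := by
      funext x; simp [fundamentalForm, inner_smul_left]
    rw [smul_apply, nablaPhiAux_apply, nablaPhiAux_apply, e, h,
      nabla.isCovariantDerivativeOn.leibniz hY hf]
    simp [fundamentalForm, inner_add_left, inner_smul_left]
    ring
  add {Y Y'} hY hY' := by
    ext u
    have h := mvfderiv_fun_add (mdifferentiableAt_fundamentalForm φ hY hZ)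
      (mdifferentiableAt_fundamentalForm φ hY' hZ)
    have e : (fun x => fundamentalForm φ x ((Y + Y') x) (Z x)) =
        fun x => fundamentalForm φ x (Y x) (Z x) + fundamentalForm φ x (Y' x) (Z x) := by
      funext x; simp [fundamentalForm, inner_add_left]
    rw [add_apply, nablaPhiAux_apply, nablaPhiAux_apply, nablaPhiAux_apply, e,
      h, nabla.isCovariantDerivativeOn.add hY hY']
    simp [fundamentalForm, inner_add_left]
    ring

lemma nablaPhiAux_tensorial₂ (nabla : CovariantDerivative (𝓡 d) (EuclideanSpace ℝ (Fin d))
      (fun x : M => TangentSpace (𝓡 d) x))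
    (φ : SmoothEndomorphismField d M) (p : M) (Y : Π x : M, TangentSpace (𝓡 d) x)
    (hY : DiffAt Y p) :
    TensorialAt (𝓡 d) (EuclideanSpace ℝ (Fin d)) (fun Z => nablaPhiAux nabla φ p Y Z) p where
  smul {f Z} hf hZ := by
    ext u
    have h := mvfderiv_fun_mul hf (mdifferentiableAt_fundamentalForm φ hY hZ)
    have e : (fun x => fundamentalForm φ x (Y x) ((f • Z) x)) =
        fun x => f x * fundamentalForm φ x (Y x) (Z x) := by
      funext x; simp [fundamentalForm, inner_smul_right]
    rw [smul_apply, nablaPhiAux_apply, nablaPhiAux_apply, e, h,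
      nabla.isCovariantDerivativeOn.leibniz hZ hf]
    simp [fundamentalForm, inner_add_right, inner_smul_right]
    ring
  add {Z Z'} hZ hZ' := by
    ext u
    have h := mvfderiv_fun_add (mdifferentiableAt_fundamentalForm φ hY hZ)
      (mdifferentiableAt_fundamentalForm φ hY hZ')
    have e : (fun x => fundamentalForm φ x (Y x) ((Z + Z') x)) =
        fun x => fundamentalForm φ x (Y x) (Z x) + fundamentalForm φ x (Y x) (Z' x) := by
      funext x; simp [fundamentalForm, inner_add_right]
    rw [add_apply, nablaPhiAux_apply, nablaPhiAux_apply, nablaPhiAux_apply, e,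
      h, nabla.isCovariantDerivativeOn.add hZ hZ']
    simp [fundamentalForm, inner_add_right]
    ring

/-- The covariant derivative `∇Φ` of the fundamental two-form at `p`, as a trilinear form:
`(X, Y, Z) ↦ (∇_X Φ)(Y, Z) = X(Φ(Y,Z)) - Φ(∇_X Y, Z) - Φ(Y, ∇_X Z)`. -/
def nablaPhi (nabla : CovariantDerivative (𝓡 d) (EuclideanSpace ℝ (Fin d))
      (fun x : M => TangentSpace (𝓡 d) x))
    (φ : SmoothEndomorphismField d M) (p : M) :
    TangentSpace (𝓡 d) p →ₗ[ℝ] TangentSpace (𝓡 d) p →ₗ[ℝ] TangentSpace (𝓡 d) p →ₗ[ℝ] ℝ :=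
  let T : TangentSpace (𝓡 d) p →L[ℝ] TangentSpace (𝓡 d) p →L[ℝ] TangentSpace (𝓡 d) p →L[ℝ] ℝ :=
    TensorialAt.mkHom₂ (fun Y Z => nablaPhiAux nabla φ p Y Z) p
      (nablaPhiAux_tensorial₁ nabla φ p) (nablaPhiAux_tensorial₂ nabla φ p)
  { toFun := fun x => LinearMap.mk₂ ℝ (fun y z => T y z x)
      (fun y y' z => congrArg (fun L => L z x) (T.map_add y y'))
      (fun c y z => congrArg (fun L => L z x) (T.map_smul c y))
      (fun y z z' => congrArg (fun L => L x) ((T y).map_add z z'))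
      (fun c y z => congrArg (fun L => L x) ((T y).map_smul c z))
    map_add' := fun x x' => by ext y z; exact map_add (T y z) x x'
    map_smul' := fun c x => by ext y z; exact map_smul (T y z) c x }

theorem nablaPhi_apply (nabla : CovariantDerivative (𝓡 d) (EuclideanSpace ℝ (Fin d))
      (fun x : M => TangentSpace (𝓡 d) x))
    (φ : SmoothEndomorphismField d M) {p : M} (X : Π x : M, TangentSpace (𝓡 d) x)
    {Y Z : Π x : M, TangentSpace (𝓡 d) x} (hY : DiffAt Y p) (hZ : DiffAt Z p) :
    nablaPhi nabla φ p (X p) (Y p) (Z p) =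
      mvfderiv (𝓡 d) (fun x => fundamentalForm φ x (Y x) (Z x)) p (X p)
        - fundamentalForm φ p (nabla Y p (X p)) (Z p)
        - fundamentalForm φ p (Y p) (nabla Z p (X p)) := by
  rw [← nablaPhiAux_apply]
  exact congrArg (fun L => L (X p)) (TensorialAt.mkHom₂_apply
    (nablaPhiAux_tensorial₁ nabla φ p) (nablaPhiAux_tensorial₂ nabla φ p) hY hZ)

end Riemannian

/-! ### The Chinea–González classes `C₉` and `C₁₀` -/

section ChineaGonzalez

variable {V : Type*} [AddCommGroup V] [Module ℝ V]

/-- The Chinea–González space `𝒞(V)` of an almost contact metric vector space `(V, φ, ξ, η)`: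
the trilinear forms with the symmetries of the covariant derivative of the fundamental form. -/
def chineaGonzalezSpace (φ : V →ₗ[ℝ] V) (ξ : V) (η : V →ₗ[ℝ] ℝ) :
    Submodule ℝ (V →ₗ[ℝ] V →ₗ[ℝ] V →ₗ[ℝ] ℝ) where
  carrier := {a | ∀ x y z, a x y z = - a x z y ∧
    a x y z = - a x (φ y) (φ z) + η y * a x ξ z + η z * a x y ξ}
  zero_mem' := by simp
  add_mem' {a b} ha hb x y z := by
    have h1 := ha x y z
    have h2 := hb x y z
    simp only [LinearMap.add_apply]
    constructor
    · linear_combination h1.1 + h2.1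
    · linear_combination h1.2 + h2.2
  smul_mem' c a ha x y z := by
    have h1 := ha x y z
    simp only [LinearMap.smul_apply, smul_eq_mul]
    constructor
    · linear_combination c * h1.1
    · linear_combination c * h1.2

/-- The class `𝒞₉`:
`a(x,y,z) = η(z) a(y,x,ξ) + η(y) a(φx,φz,ξ)`. -/
def classC9 (φ : V →ₗ[ℝ] V) (ξ : V) (η : V →ₗ[ℝ] ℝ) :
    Submodule ℝ (V →ₗ[ℝ] V →ₗ[ℝ] V →ₗ[ℝ] ℝ) where
  carrier := {a | a ∈ chineaGonzalezSpace φ ξ η ∧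
    ∀ x y z, a x y z = η z * a y x ξ + η y * a (φ x) (φ z) ξ}
  zero_mem' := ⟨Submodule.zero_mem _, by simp⟩
  add_mem' {a b} ha hb := ⟨Submodule.add_mem _ ha.1 hb.1, fun x y z => by
    simp only [LinearMap.add_apply]
    linear_combination ha.2 x y z + hb.2 x y z⟩
  smul_mem' c a ha := ⟨Submodule.smul_mem _ c ha.1, fun x y z => by
    simp only [LinearMap.smul_apply, smul_eq_mul]
    linear_combination c * ha.2 x y z⟩

/-- The class `𝒞₁₀`:
`a(x,y,z) = -η(z) a(y,x,ξ) + η(y) a(φx,φz,ξ)`. -/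
def classC10 (φ : V →ₗ[ℝ] V) (ξ : V) (η : V →ₗ[ℝ] ℝ) :
    Submodule ℝ (V →ₗ[ℝ] V →ₗ[ℝ] V →ₗ[ℝ] ℝ) where
  carrier := {a | a ∈ chineaGonzalezSpace φ ξ η ∧
    ∀ x y z, a x y z = - (η z * a y x ξ) + η y * a (φ x) (φ z) ξ}
  zero_mem' := ⟨Submodule.zero_mem _, by simp⟩
  add_mem' {a b} ha hb := ⟨Submodule.add_mem _ ha.1 hb.1, fun x y z => by
    simp only [LinearMap.add_apply]
    linear_combination ha.2 x y z + hb.2 x y z⟩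
  smul_mem' c a ha := ⟨Submodule.smul_mem _ c ha.1, fun x y z => by
    simp only [LinearMap.smul_apply, smul_eq_mul]
    linear_combination c * ha.2 x y z⟩

end ChineaGonzalez

section Class

variable {d : ℕ} {M : Type*} [TopologicalSpace M] [ChartedSpace (EuclideanSpace ℝ (Fin d)) M]
  [IsManifold (𝓡 d) ∞ M] [RiemannianBundle (fun x : M => TangentSpace (𝓡 d) x)]
  [IsContMDiffRiemannianBundle (𝓡 d) ∞ (EuclideanSpace ℝ (Fin d))
    (fun x : M => TangentSpace (𝓡 d) x)]

/-- The almost contact metric structure is of class `C₉ ⊕ C₁₀`: at every point `p`, the covariant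
derivative of the fundamental form lies in `𝒞₉(T_pM) + 𝒞₁₀(T_pM)`. -/
def IsClassC9C10 (nabla : CovariantDerivative (𝓡 d) (EuclideanSpace ℝ (Fin d))
      (fun x : M => TangentSpace (𝓡 d) x))
    (φ : SmoothEndomorphismField d M) (ξ : SmoothVectorField d M) (η : SmoothOneForm d M) : Prop :=
  ∀ p : M, nablaPhi nabla φ p ∈
    classC9 (φ p : TangentSpace (𝓡 d) p →ₗ[ℝ] TangentSpace (𝓡 d) p) (ξ p)
        (η.at p : TangentSpace (𝓡 d) p →ₗ[ℝ] ℝ) ⊔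
      classC10 (φ p : TangentSpace (𝓡 d) p →ₗ[ℝ] TangentSpace (𝓡 d) p) (ξ p)
        (η.at p : TangentSpace (𝓡 d) p →ₗ[ℝ] ℝ)

/-! ### Sectional curvature -/

/-- `R(X,Y)Z = ∇_X ∇_Y Z - ∇_Y ∇_X Z - ∇_{[X,Y]} Z` -/
def curvature (nabla : CovariantDerivative (𝓡 d) (EuclideanSpace ℝ (Fin d))
      (fun x : M => TangentSpace (𝓡 d) x))
    (X Y Z : Π x : M, TangentSpace (𝓡 d) x) (p : M) : TangentSpace (𝓡 d) p :=
  nabla (fun q => nabla Z q (Y q)) p (X p) - nabla (fun q => nabla Z q (X q)) p (Y p)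
    - nabla Z p (mlieBracket (𝓡 d) X Y p)

/-- The sectional curvature of the plane spanned by two vector fields at `p`. -/
def sectionalCurvature (nabla : CovariantDerivative (𝓡 d) (EuclideanSpace ℝ (Fin d))
      (fun x : M => TangentSpace (𝓡 d) x))
    (X Y : Π x : M, TangentSpace (𝓡 d) x) (p : M) : ℝ :=
  ⟪curvature nabla X Y Y p, X p⟫_ℝ / (⟪X p, X p⟫_ℝ * ⟪Y p, Y p⟫_ℝ - ⟪X p, Y p⟫_ℝ ^ 2)

/-- The sectional curvature `K_p(P)` of the 2-plane `P` in `T_pM` equals `c`: it is computed from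
any smooth vector fields `X`, `Y` for which `X_p`, `Y_p` is a basis of `P`. -/
def HasSectionalCurvature (nabla : CovariantDerivative (𝓡 d) (EuclideanSpace ℝ (Fin d))
      (fun x : M => TangentSpace (𝓡 d) x))
    (p : M) (P : Submodule ℝ (TangentSpace (𝓡 d) p)) (c : ℝ) : Prop :=
  ∀ X Y : SmoothVectorField d M, LinearIndependent ℝ ![X p, Y p] →
    Submodule.span ℝ {X p, Y p} = P → sectionalCurvature nabla X Y p = c

end Class

end ContactGeometry

end

noncomputable section

set_option linter.unusedSectionVars false

namespace ContactGeometry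

/-! ### Alternating forms and complex structures -/

section ComplexStructure

/-! Everything rests on the endomorphism `A = ∇ξ` of `D = ker η` and the complex structure `J =
φ|_D`. The class condition makes `A` anti-linear, `AJ = -JA` (`nabla_xi_phi`), and kills `∇_ξ ξ`. On
`D` the form `dη` is `θ(x, y) = ⟨Ax, y⟩ - ⟨Ay, x⟩`; the contact condition makes it nondegenerate,
and anti-linearity gives `θ(Jx, Jy) = -θ(x, y)`.

Dimension `4n + 1`: such a `θ` is the real part of a nondegenerate alternating form on `D` that is
bilinear over `ℂ`. Hence `D` has even complex dimension (`four_dvd_finrank_of_alternating`).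

Dimension 5: the class condition determines `∇φ` from `A`, and a second differentiation
(`inner_curvature_phi`) gives `⟨R(x, y)Jz, w⟩ + ⟨R(x, y)z, Jw⟩ = -(Ax ∧ Ay)(z, w)` on `D`, with `∧`
the complex wedge. Constant sectional curvature `c` on the planes of `D` determines `R` on `D` and
turns the left side into `c (x ∧ y)(z, w)`. So `Ax ∧ Ay = -c x ∧ y`. Replacing `x` by `Jx` gives
opposite signs on the two sides, so `c = 0` once `dim D > 2`. Then `Ax ∧ Ay = 0`, so `A` has complex
rank at most 1 and its skew part has complex rank at most 2. Nondegeneracy of `θ` then gives `dim D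
≤ 4`.

Second covariant derivatives exist thanks to the global unit field `ξ`: derivatives of functions are
read off from Lie brackets with multiples of `ξ`, and `∇_X Y` is then controlled by the Koszul
formula. -/

/-- A complex space carrying a nondegenerate alternating bilinear form has even dimension. -/
lemma even_finrank_of_isAlt_of_nondegenerate {V : Type*} [AddCommGroup V] [Module ℂ V]
    [FiniteDimensional ℂ V] (B : LinearMap.BilinForm ℂ V) (hB : B.IsAlt) (hB' : B.Nondegenerate) :
    Even (Module.finrank ℂ V) := by
  by_contra hodd
  rw [Nat.not_even_iff_odd] at hodd
  let b := Module.finBasis ℂ V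
  refine (LinearMap.BilinForm.nondegenerate_iff_det_ne_zero b).1 hB' ?_
  set N := LinearMap.BilinForm.toMatrix b B with hN
  have hT : N.transpose = - N := by
    ext i j
    simp only [hN, Matrix.transpose_apply, Matrix.neg_apply, LinearMap.BilinForm.toMatrix_apply]
    exact (hB.neg_eq _ _).symm
  have h := Matrix.det_transpose N
  rw [hT, Matrix.det_neg, Fintype.card_fin, hodd.neg_one_pow] at h
  linear_combination (-1 / 2 : ℂ) * h

/-- A space carrying a complex structure and a nondegenerate alternating form that changes sign
under the complex structure has dimension divisible by four. -/
lemma four_dvd_finrank_of_alternating {W : Type*} [AddCommGroup W] [Module ℝ W]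
    [FiniteDimensional ℝ W] (J : W →ₗ[ℝ] W) (hJ : ∀ x, J (J x) = -x)
    (θ : W →ₗ[ℝ] W →ₗ[ℝ] ℝ) (hθ : ∀ x y, θ x y = - θ y x)
    (hJθ : ∀ x y, θ (J x) (J y) = - θ x y) (hnd : ∀ x, (∀ y, θ x y = 0) → x = 0) :
    4 ∣ Module.finrank ℝ W := by
  have hJJ : (J : Module.End ℝ W) * J = -1 := by
    ext x
    simpa using hJ x
  let : Module ℂ W := Module.compHom W (Complex.liftAux (A := Module.End ℝ W) J hJJ).toRingHom
  have hsmul : ∀ (z : ℂ) (x : W), z • x = z.re • x + z.im • J x := by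
    intro z x
    change (Complex.liftAux (A := Module.End ℝ W) J hJJ) z x = _
    rw [Complex.liftAux_apply]
    simp [Module.algebraMap_end_apply]
  have : IsScalarTower ℝ ℂ W := ⟨fun r z x => by
    simp only [hsmul, Complex.real_smul, Complex.mul_re, Complex.mul_im, Complex.ofReal_re,
      Complex.ofReal_im]
    simp only [zero_mul, sub_zero, add_zero]
    module⟩
  have : FiniteDimensional ℂ W := FiniteDimensional.right ℝ ℂ W
  -- `J` is self-adjoint for `θ`; this is what makes `B` below linear over `ℂ` in the second
  -- argument as well.
  have hJ' : ∀ x y, θ x (J y) = θ (J x) y := by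
    intro x y
    have h := hJθ (J x) y
    rw [hJ, map_neg, LinearMap.neg_apply] at h
    linarith
  -- The imaginary part is forced by the real part: `B (i x) y = i B x y` requires `Im B x y = -Re B
  -- (J x) y`.
  let B : LinearMap.BilinForm ℂ W := LinearMap.mk₂ ℂ
    (fun x y => (⟨θ x y, - θ (J x) y⟩ : ℂ))
    (fun x x' y => by apply Complex.ext <;> simp; ring)
    (fun z x y => by
      apply Complex.ext <;> simp [hsmul, hJ]
      ring)
    (fun x y y' => by apply Complex.ext <;> simp; ring)
    (fun z x y => by
      apply Complex.ext <;> simp [hsmul, hJ', hJ]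
      ring)
  have hBalt : B.IsAlt := by
    intro x
    have h1 := hθ x x
    have h2 := hθ (J x) x
    rw [hJ'] at h2
    apply Complex.ext
    · change θ x x = 0; linarith
    · change - θ (J x) x = 0; linarith
  have hBnd : B.Nondegenerate := by
    have hl : ∀ x, (∀ y, B x y = 0) → x = 0 := fun x hx =>
      hnd x fun y => congrArg Complex.re (hx y)
    refine ⟨hl, fun y hy => hl y fun x => ?_⟩
    rw [← hBalt.neg_eq, hy, neg_zero]
  obtain ⟨k, hk⟩ := even_finrank_of_isAlt_of_nondegenerate B hBalt hBnd
  have h := Module.finrank_mul_finrank ℝ ℂ W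
  rw [Complex.finrank_real_complex] at h
  omega

end ComplexStructure

/-! ### Algebraic curvature tensors of constant sectional curvature -/

section AlgebraicCurvature

/-- An algebraic curvature tensor with vanishing sectional curvatures vanishes. -/
lemma algebraicCurvature_eq_zero {W : Type*} [AddCommGroup W] (T : W → W → W → W → ℝ)
    (hadd : ∀ x x' y z w, T (x + x') y z w = T x y z w + T x' y z w)
    (hskew : ∀ x y z w, T x y z w = - T y x z w)
    (hskew' : ∀ x y z w, T x y z w = - T x y w z)
    (hbianchi : ∀ x y z w, T x y z w + T y z x w + T z x y w = 0)
    (hsec : ∀ x y, T x y y x = 0) (x y z w : W) : T x y z w = 0 := by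
  have hpair : ∀ x y z w, T x y z w = T z w x y := by
    intro x y z w
    -- Pair symmetry is the usual combination of the four cyclic identities for `x, y, z, w`.
    linarith [hbianchi x y z w, hbianchi y z w x, hbianchi z w x y, hbianchi w x y z,
      hskew' x y z w, hskew' y z x w, hskew' z x y w, hskew' z w y x, hskew' w y z x,
      hskew' y z w x, hskew' w x z y, hskew' x z w y, hskew' z w x y, hskew' x y w z,
      hskew' y w x z, hskew' w x y z, hskew y z w x, hskew z x w y, hskew w y z x,
      hskew x z w y, hskew y w x z, hskew w x y z, hskew z w x y, hskew x y z w]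
  have hadd2 : ∀ x y y' z w, T x (y + y') z w = T x y z w + T x y' z w := by
    intro x y y' z w
    rw [hskew, hadd, hskew y, hskew y']; ring
  have hadd3 : ∀ x y z z' w, T x y (z + z') w = T x y z w + T x y z' w := by
    intro x y z z' w
    rw [hpair, hadd, hpair z, hpair z']
  have hadd4 : ∀ x y z w w', T x y z (w + w') = T x y z w + T x y z w' := by
    intro x y z w w'
    rw [hskew', hadd3, hskew' x y w, hskew' x y w']; ring
  have h1 : ∀ x y z, T x y z x = 0 := by
    intro x y z
    have h := hsec x (y + z)
    rw [hadd2, hadd3, hadd3, hsec, hsec] at h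
    have h' : T x z y x = T x y z x := by
      rw [hpair, hskew, hskew', neg_neg]
    linarith
  have h2 : ∀ x y z w, T x y z w = - T w y z x := by
    intro x y z w
    have h := h1 (x + w) y z
    rw [hadd, hadd4, hadd4, h1, h1] at h
    linarith
  have h3 : ∀ x y z w, T x y z w = - T z y x w := by
    intro x y z w
    rw [h2, hskew', neg_neg, h2]
  -- After polarization `T` is totally skew, hence invariant under cyclic permutations, and the
  -- Bianchi identity reads `3T = 0`.
  have hcyc : ∀ x y z w, T y z x w = T x y z w := by
    intro x y z w
    rw [hskew, ← h3]
  have h := hbianchi x y z w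
  rw [hcyc y z x w, hcyc x y z w] at h
  linarith

/-- An algebraic curvature tensor of constant sectional curvature `c` is determined by `c`. -/
lemma algebraicCurvature_eq_of_constant {W : Type*} [NormedAddCommGroup W]
    [InnerProductSpace ℝ W] (K : W → W → W → W → ℝ)
    (hadd : ∀ x x' y z w, K (x + x') y z w = K x y z w + K x' y z w)
    (hsmul : ∀ (a : ℝ) x y z w, K (a • x) y z w = a * K x y z w)
    (hskew : ∀ x y z w, K x y z w = - K y x z w)
    (hskew' : ∀ x y z w, K x y z w = - K x y w z)
    (hbianchi : ∀ x y z w, K x y z w + K y z x w + K z x y w = 0) (c : ℝ)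
    (hsec : ∀ x y, LinearIndependent ℝ ![x, y] →
      K x y y x = c * (⟪x, x⟫_ℝ * ⟪y, y⟫_ℝ - ⟪x, y⟫_ℝ ^ 2)) (x y z w : W) :
    K x y z w = c * (⟪y, z⟫_ℝ * ⟪x, w⟫_ℝ - ⟪x, z⟫_ℝ * ⟪y, w⟫_ℝ) := by
  have key := algebraicCurvature_eq_zero
    (fun x y z w => K x y z w - c * (⟪y, z⟫_ℝ * ⟪x, w⟫_ℝ - ⟪x, z⟫_ℝ * ⟪y, w⟫_ℝ))
    (fun x x' y z w => by simp only [hadd, inner_add_left]; ring)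
    (fun x y z w => by rw [hskew]; ring)
    (fun x y z w => by rw [hskew']; ring)
    (fun x y z w => by
      rw [real_inner_comm x z, real_inner_comm x y, real_inner_comm y z]
      linear_combination hbianchi x y z w)
    (fun x y => by
      have hself : ∀ u z w, K u u z w = 0 := fun u z w => by linarith [hskew u u z w]
      by_cases hxy : LinearIndependent ℝ ![x, y]
      · rw [hsec x y hxy, real_inner_comm x y]; ring
      -- `hsec` is silent on dependent pairs. There both sides vanish: either `y = 0`, or `x` is a
      -- multiple of `y`.
      · by_cases hy : y = 0
        · subst hy
          have h0 := hsmul 0 0 x 0 x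
          rw [zero_smul, zero_mul] at h0
          rw [hskew, h0]
          simp
        · rw [LinearIndependent.pair_symm_iff, LinearIndependent.pair_iff' hy] at hxy
          push Not at hxy
          obtain ⟨a, rfl⟩ := hxy
          rw [hsmul, hself]
          simp only [inner_smul_left, inner_smul_right, RCLike.conj_to_real]
          ring) x y z w
  linarith

/-- Equality case of Cauchy–Schwarz: the vector `⟪x, x⟫ y - ⟪x, y⟫ x` has squared length `⟪x, x⟫`
times the Gram determinant. -/
lemma gram_ne_zero_of_linearIndependent {W : Type*} [NormedAddCommGroup W]
    [InnerProductSpace ℝ W] {x y : W} (hxy : LinearIndependent ℝ ![x, y]) :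
    ⟪x, x⟫_ℝ * ⟪y, y⟫_ℝ - ⟪x, y⟫_ℝ ^ 2 ≠ 0 := by
  intro h0
  have hx0 : x ≠ 0 := hxy.ne_zero 0
  have h1 : ⟪⟪x, x⟫_ℝ • y - ⟪x, y⟫_ℝ • x, ⟪x, x⟫_ℝ • y - ⟪x, y⟫_ℝ • x⟫_ℝ = 0 := by
    simp only [inner_sub_left, inner_sub_right, inner_smul_left, inner_smul_right,
      RCLike.conj_to_real, real_inner_comm x y]
    linear_combination ⟪x, x⟫_ℝ * h0
  have h2 := inner_self_eq_zero.1 h1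
  have h3 := LinearIndependent.pair_iff.1 hxy (- ⟪x, y⟫_ℝ) ⟪x, x⟫_ℝ
    (by rw [← h2]; module)
  exact hx0 (inner_self_eq_zero.1 h3.2)

end AlgebraicCurvature
/-! ### Wedge identities for anti-linear maps -/

section Hermitian

variable {W : Type*} [NormedAddCommGroup W] [InnerProductSpace ℝ W]

/-- The value on `(z, w)` of the complex bilinear part of the bivector `x ∧ y`. -/
def complexWedge (J : W →ₗ[ℝ] W) (x y z w : W) : ℝ :=
  ⟪y, J z⟫_ℝ * ⟪x, w⟫_ℝ - ⟪x, J z⟫_ℝ * ⟪y, w⟫_ℝ + ⟪y, z⟫_ℝ * ⟪x, J w⟫_ℝ - ⟪x, z⟫_ℝ * ⟪y, J w⟫_ℝ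

variable {J : W →ₗ[ℝ] W}

lemma inner_complexStructure_self (hJs : ∀ x y, ⟪J x, y⟫_ℝ = - ⟪x, J y⟫_ℝ) (x : W) :
    ⟪x, J x⟫_ℝ = 0 := by
  have h := hJs x x
  rw [real_inner_comm] at h
  linarith

/-- This is the sense in which the wedge is complex bilinear: a factor `J` passes from the bivector
to the argument `z`, up to sign. -/
lemma complexWedge_complexStructure_left (hJ : ∀ x, J (J x) = -x)
    (hJs : ∀ x y, ⟪J x, y⟫_ℝ = - ⟪x, J y⟫_ℝ) (x y z w : W) :
    complexWedge J (J x) y z w = - complexWedge J x y (J z) w := by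
  simp only [complexWedge, hJs, hJ, inner_neg_right]
  ring

/-- If an anti-linear map `A` scales all complex bivectors by `-c`, then `c = 0`. -/
lemma eq_zero_of_complexWedge [FiniteDimensional ℝ W] (hJ : ∀ x, J (J x) = -x)
    (hJs : ∀ x y, ⟪J x, y⟫_ℝ = - ⟪x, J y⟫_ℝ) (hdim : 2 < Module.finrank ℝ W)
    (A : W →ₗ[ℝ] W) (hAJ : ∀ x, A (J x) = - J (A x)) (c : ℝ)
    (h : ∀ x y z w, complexWedge J (A x) (A y) z w = - (c * complexWedge J x y z w)) : c = 0 := by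
  -- Put `J x` for `x` in `h`. Pulling `J` out of `A (J x)` costs a sign that pulling it out of `x`
  -- does not, so the two sides of `h` disagree in sign and must vanish.
  have hzero : ∀ x y z w, c * complexWedge J (J x) y z w = 0 := by
    intro x y z w
    have h1 := h (J x) y z w
    have h2 := h x y (J z) w
    have h3 := complexWedge_complexStructure_left hJ hJs x y z w
    have h4 := complexWedge_complexStructure_left hJ hJs (A x) (A y) z w
    have h5 : complexWedge J (A (J x)) (A y) z w = - complexWedge J (J (A x)) (A y) z w := by
      rw [hAJ]
      simp only [complexWedge, inner_neg_left]
      ring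
    rw [h5] at h1
    linear_combination (1 / 2 : ℝ) * (h1 - h2 + c * h3 + h4)
  obtain ⟨x, hx⟩ : ∃ x : W, x ≠ 0 := by
    by_contra! hne
    have : Subsingleton W := ⟨fun a b => by rw [hne a, hne b]⟩
    rw [Module.finrank_zero_of_subsingleton] at hdim
    omega
  obtain ⟨y, hy, hyx, hyJx⟩ : ∃ y : W, y ≠ 0 ∧ ⟪x, y⟫_ℝ = 0 ∧ ⟪J x, y⟫_ℝ = 0 := by
    -- Two real conditions, so a nonzero solution exists as soon as the dimension exceeds 2.
    let f : W →ₗ[ℝ] ℝ × ℝ := (innerₛₗ ℝ x).prod (innerₛₗ ℝ (J x))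
    have hker : LinearMap.ker f ≠ ⊥ := LinearMap.ker_ne_bot_of_finrank_lt (by simpa using hdim)
    obtain ⟨y, hy, hy0⟩ := Submodule.exists_mem_ne_zero_of_ne_bot hker
    rw [LinearMap.mem_ker] at hy
    exact ⟨y, hy0, congrArg Prod.fst hy, congrArg Prod.snd hy⟩
  -- With `y` orthogonal to `x` and `J x`, the only surviving term of the wedge at `(J y, x)` is
  -- `⟪y, y⟫ ⟪x, x⟫`.
  have h1 := hzero (J x) y (J y) x
  rw [hJ] at h1
  have hxJy : ⟪x, J y⟫_ℝ = 0 := by linarith [hJs x y]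
  simp only [complexWedge, hJ, inner_neg_left, inner_neg_right, hyx, hxJy,
    inner_complexStructure_self hJs, real_inner_comm x y] at h1
  have hx' := real_inner_self_pos.2 hx
  have hy' := real_inner_self_pos.2 hy
  have h2 : c * (⟪y, y⟫_ℝ * ⟪x, x⟫_ℝ) = 0 := by
    rw [← h1]; ring
  exact (mul_eq_zero.1 h2).resolve_right (mul_pos hy' hx').ne'

/-- If an anti-linear map `A` has complex rank at most one and the skew part of `A` is
nondegenerate, then the real dimension is at most four. -/
lemma finrank_le_four_of_complexWedge [FiniteDimensional ℝ W] (hJ : ∀ x, J (J x) = -x)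
    (hJs : ∀ x y, ⟪J x, y⟫_ℝ = - ⟪x, J y⟫_ℝ) (A : W →ₗ[ℝ] W)
    (h : ∀ x y z w, complexWedge J (A x) (A y) z w = 0)
    (hnd : ∀ x, (∀ y, ⟪A x, y⟫_ℝ - ⟪A y, x⟫_ℝ = 0) → x = 0) : Module.finrank ℝ W ≤ 4 := by
  by_cases hA : ∀ x, A x = 0
  · have : Subsingleton W := ⟨fun a b => by
      rw [hnd a fun y => by simp [hA], hnd b fun y => by simp [hA]]⟩
    rw [Module.finrank_zero_of_subsingleton]
    omega
  push Not at hA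
  obtain ⟨x₀, hx₀⟩ := hA
  set u := A x₀ with hu
  have hupos := real_inner_self_pos.2 hx₀
  -- `u ∧ A y = 0` over `ℂ`, so the image of `A` is the complex line through `u`.
  have hspan : ∀ y, ⟪u, u⟫_ℝ • A y = ⟪A y, u⟫_ℝ • u + ⟪A y, J u⟫_ℝ • J u := by
    intro y
    refine ext_inner_right ℝ fun z => ?_
    have h1 := h x₀ y (J z) u
    simp only [complexWedge, ← hu, hJ, inner_neg_right, inner_complexStructure_self hJs] at h1
    simp only [inner_smul_left, inner_add_left, RCLike.conj_to_real, hJs]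
    linear_combination -h1
  -- Four real conditions cut out the kernel of the skew part: `A x = 0`, and `x` orthogonal to the
  -- image of `A`. Nondegeneracy makes `f` injective.
  let f : W →ₗ[ℝ] (ℝ × ℝ) × (ℝ × ℝ) :=
    ((innerₛₗ ℝ u).prod (innerₛₗ ℝ (J u))).prod
      (((innerₛₗ ℝ u).prod (innerₛₗ ℝ (J u))).comp A)
  have hf : Function.Injective f := by
    rw [← LinearMap.ker_eq_bot, LinearMap.ker_eq_bot']
    intro x hx
    have h1 : ⟪u, x⟫_ℝ = 0 := congrArg (fun q => q.1.1) hx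
    have h2 : ⟪J u, x⟫_ℝ = 0 := congrArg (fun q => q.1.2) hx
    have h3 : ⟪u, A x⟫_ℝ = 0 := congrArg (fun q => q.2.1) hx
    have h4 : ⟪J u, A x⟫_ℝ = 0 := congrArg (fun q => q.2.2) hx
    have hAx : A x = 0 := by
      have h5 := hspan x
      rw [real_inner_comm u (A x), h3, real_inner_comm (J u) (A x), h4, zero_smul,
        zero_smul, add_zero] at h5
      exact (smul_eq_zero.1 h5).resolve_left hupos.ne'
    refine hnd x fun y => ?_
    have h6 := congrArg (fun v => ⟪v, x⟫_ℝ) (hspan y)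
    simp only [inner_smul_left, inner_add_left, h1, h2, RCLike.conj_to_real] at h6
    have h7 : ⟪A y, x⟫_ℝ = 0 := by
      have : ⟪u, u⟫_ℝ * ⟪A y, x⟫_ℝ = 0 := by linarith
      exact (mul_eq_zero.1 this).resolve_left hupos.ne'
    rw [hAx, inner_zero_left, h7, sub_zero]
  simpa using LinearMap.finrank_le_finrank_of_injective hf

end Hermitian

/-! ### Degenerate contact volumes -/

section Volume

/-- A product of factors, each of which is linear in the arguments that it owns, is multilinear. -/
lemma exists_multilinear_prod {ι κ V : Type*} [DecidableEq ι] [Fintype κ] [DecidableEq κ]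
    [AddCommGroup V] [Module ℝ V] (g : κ → (ι → V) → ℝ) (own : ι → κ)
    (hne : ∀ k i v x, k ≠ own i → g k (Function.update v i x) = g k v)
    (hadd : ∀ i v x y, g (own i) (Function.update v i (x + y)) =
      g (own i) (Function.update v i x) + g (own i) (Function.update v i y))
    (hsmul : ∀ i v (c : ℝ) x, g (own i) (Function.update v i (c • x)) =
      c * g (own i) (Function.update v i x)) :
    ∃ f : MultilinearMap ℝ (fun _ : ι => V) ℝ, ∀ v, f v = ∏ k, g k v := by
  have key : ∀ i v x, ∏ k, g k (Function.update v i x) =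
      g (own i) (Function.update v i x) * ∏ k ∈ Finset.univ.erase (own i), g k v := by
    intro i v x
    rw [← Finset.mul_prod_erase _ _ (Finset.mem_univ (own i))]
    congr 1
    exact Finset.prod_congr rfl fun k hk => hne k i v x (Finset.ne_of_mem_erase hk)
  refine ⟨MultilinearMap.mk' (fun v => ∏ k, g k v) ?_ ?_, fun v => rfl⟩
  · intro v i x y
    rw [key, key, key, hadd, add_mul]
  · intro v i c x
    rw [key, key, hsmul, smul_eq_mul, mul_assoc]

/-- The alternating sum `∑ sign σ • η(v_σ0) ∏ θ(v_σ(2i+1), v_σ(2i+2))` vanishes if `η` and `θ` have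
a common kernel vector. -/
lemma sum_perm_prod_eq_zero {m : ℕ} {V : Type*} [AddCommGroup V] [Module ℝ V]
    [FiniteDimensional ℝ V] (hdim : Module.finrank ℝ V = 2 * m + 1) (η : V →ₗ[ℝ] ℝ)
    (θ : V →ₗ[ℝ] V →ₗ[ℝ] ℝ) {x : V} (hx : x ≠ 0) (hη : η x = 0) (hθ : ∀ y, θ x y = 0)
    (hθ' : ∀ y, θ y x = 0) (v : Fin (2 * m + 1) → V) :
    ∑ σ : Equiv.Perm (Fin (2 * m + 1)), ((Equiv.Perm.sign σ : ℤ) : ℝ) *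
      (η (v (σ ⟨0, by omega⟩)) *
        ∏ i : Fin m, θ (v (σ ⟨2 * i + 1, by omega⟩)) (v (σ ⟨2 * i + 2, by omega⟩))) = 0 := by
  obtain ⟨f, hf⟩ : ∃ f : MultilinearMap ℝ (fun _ : Fin (2 * m + 1) => V) ℝ, ∀ v, f v =
      η (v ⟨0, by omega⟩) * ∏ i : Fin m, θ (v ⟨2 * i + 1, by omega⟩) (v ⟨2 * i + 2, by omega⟩) := by
    let g : Option (Fin m) → (Fin (2 * m + 1) → V) → ℝ := fun k v =>
      k.elim (η (v ⟨0, by omega⟩))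
        fun i => θ (v ⟨2 * i + 1, by omega⟩) (v ⟨2 * i + 2, by omega⟩)
    -- Slot 0 belongs to `η`; a slot `j > 0` belongs to the pair `{2i + 1, 2i + 2}` with `i = (j -
    -- 1) / 2`.
    let own : Fin (2 * m + 1) → Option (Fin m) := fun j =>
      if h : j.1 = 0 then none else some ⟨(j.1 - 1) / 2, by omega⟩
    have hcases : ∀ j : Fin (2 * m + 1), (j = ⟨0, by omega⟩ ∧ own j = none) ∨
        (∃ i : Fin m, j = ⟨2 * i + 1, by omega⟩ ∧ own j = some i) ∨
        (∃ i : Fin m, j = ⟨2 * i + 2, by omega⟩ ∧ own j = some i) := by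
      intro j
      by_cases h : j.1 = 0
      · exact Or.inl ⟨Fin.ext h, dif_pos h⟩
      · rcases Nat.even_or_odd' j.1 with ⟨k, hk | hk⟩
        · refine Or.inr (Or.inr ⟨⟨k - 1, by omega⟩, Fin.ext (by simp; omega), ?_⟩)
          simp only [own, h, dite_false, Option.some.injEq, Fin.mk.injEq]
          omega
        · refine Or.inr (Or.inl ⟨⟨k, by omega⟩, Fin.ext (by simp; omega), ?_⟩)
          simp only [own, h, dite_false, Option.some.injEq, Fin.mk.injEq]
          omega
    obtain ⟨f, hf⟩ := exists_multilinear_prod g own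
      (by
        intro k j v y hk
        have hne : ∀ l, own l = k → l ≠ j := fun l hl hlj => hk (by rw [← hlj, hl])
        rcases k with _ | k
        · change η _ = η _
          rw [Function.update_of_ne (hne _ rfl)]
        · have h1 : own ⟨2 * k + 1, by omega⟩ = some k := by simp [own]
          have h2 : own ⟨2 * k + 2, by omega⟩ = some k := by
            simp only [own, Nat.add_eq_zero_iff, OfNat.ofNat_ne_zero, and_false, dite_false,
              Option.some.injEq]
            exact Fin.ext (by simp; omega)
          change θ _ _ = θ _ _
          rw [Function.update_of_ne (hne _ h1), Function.update_of_ne (hne _ h2)])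
      (by
        intro j v y z
        rcases hcases j with ⟨rfl, h⟩ | ⟨i, rfl, h⟩ | ⟨i, rfl, h⟩ <;> rw [h] <;>
          simp [g])
      (by
        intro j v c y
        rcases hcases j with ⟨rfl, h⟩ | ⟨i, rfl, h⟩ | ⟨i, rfl, h⟩ <;> rw [h] <;>
          simp [g])
    exact ⟨f, fun v => by rw [hf, Fintype.prod_option]; rfl⟩
  have halt : ∀ v, MultilinearMap.alternatization f v =
      ∑ σ : Equiv.Perm (Fin (2 * m + 1)), ((Equiv.Perm.sign σ : ℤ) : ℝ) *
      (η (v (σ ⟨0, by omega⟩)) *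
        ∏ i : Fin m, θ (v (σ ⟨2 * i + 1, by omega⟩)) (v (σ ⟨2 * i + 2, by omega⟩))) := by
    intro v
    rw [MultilinearMap.alternatization_apply]
    refine Finset.sum_congr rfl fun σ _ => ?_
    rw [MultilinearMap.domDomCongr_apply, hf, Units.smul_def, zsmul_eq_mul]
  rw [← halt]
  -- A top-degree alternating form is determined by its value on one basis. On a basis containing
  -- `x`, every summand has a factor in which `x` is fed to `η` or to `θ`.
  obtain ⟨b, i₀, hb⟩ : ∃ (b : Module.Basis (Fin (2 * m + 1)) ℝ V) (i₀ : _), b i₀ = x := by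
    have hli : LinearIndepOn ℝ id {x} := LinearIndepOn.singleton hx
    let b₀ := Module.Basis.extend hli
    let x₀ : (hli.extend (Set.subset_univ _) : Set V) :=
      ⟨x, hli.subset_extend (Set.subset_univ _) rfl⟩
    have := Module.Finite.finite_basis b₀
    have := Fintype.ofFinite (hli.extend (Set.subset_univ ({x} : Set V)))
    have hcard : Fintype.card (hli.extend (Set.subset_univ ({x} : Set V))) =
        Fintype.card (Fin (2 * m + 1)) := by
      rw [← Module.finrank_eq_card_basis b₀, hdim, Fintype.card_fin]
    let e := Fintype.equivOfCardEq hcard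
    refine ⟨b₀.reindex e, e x₀, ?_⟩
    rw [Module.Basis.reindex_apply, Equiv.symm_apply_apply]
    exact Module.Basis.extend_apply_self hli x₀
  have hfb : MultilinearMap.alternatization f b = 0 := by
    rw [halt]
    refine Finset.sum_eq_zero fun σ _ => ?_
    obtain ⟨j, rfl⟩ := σ.surjective i₀
    rcases Nat.eq_zero_or_pos j.1 with h0 | hpos
    · have hj : (⟨0, by omega⟩ : Fin (2 * m + 1)) = j := Fin.ext h0.symm
      rw [hj, hb, hη, zero_mul, mul_zero]
    · rw [Finset.prod_eq_zero (Finset.mem_univ (⟨(j.1 - 1) / 2, by omega⟩ : Fin m)), mul_zero,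
        mul_zero]
      rcases Nat.even_or_odd' j.1 with ⟨k, hk | hk⟩
      · have hj : (⟨2 * ((j.1 - 1) / 2) + 2, by omega⟩ : Fin (2 * m + 1)) = j :=
          Fin.ext (by simp; omega)
        rw [hj, hb, hθ']
      · have hj : (⟨2 * ((j.1 - 1) / 2) + 1, by omega⟩ : Fin (2 * m + 1)) = j :=
          Fin.ext (by simp; omega)
        rw [hj, hb, hθ]
  rw [AlternatingMap.eq_smul_basis_det b (MultilinearMap.alternatization f), hfb]
  simp

end Volume

/-! ### Smooth vector fields with prescribed values -/

section Extension

variable {d : ℕ} {M : Type*} [TopologicalSpace M] [ChartedSpace (EuclideanSpace ℝ (Fin d)) M]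
  [IsManifold (𝓡 d) ∞ M]

lemma SmoothVectorField.diffAt (X : SmoothVectorField d M) (p : M) : DiffAt X p :=
  X.contMDiff.mdifferentiable (by simp) p

/-- The Lie bracket of smooth vector fields. -/
def lieBracketField (X Y : SmoothVectorField d M) : SmoothVectorField d M :=
  ⟨mlieBracket (𝓡 d) X Y, by
    have : IsManifold (𝓡 d) (((⊤ : ℕ∞) : WithTop ℕ∞) + 1) M := by
      simpa using ‹IsManifold (𝓡 d) ∞ M›
    have : IsManifold (𝓡 d) (minSmoothness ℝ 2) M := by
      rw [minSmoothness_of_isRCLikeNormedField]; infer_instance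
    exact ContDiff.mlieBracket_vectorField (m := ⊤) (n := ⊤) X.contMDiff Y.contMDiff (by simp)⟩

@[simp]
lemma lieBracketField_apply (X Y : SmoothVectorField d M) (p : M) :
    lieBracketField X Y p = mlieBracket (𝓡 d) X Y p := rfl

/-- The product of a smooth function and a smooth vector field. -/
def smulField (f : M → ℝ) (hf : ContMDiff (𝓡 d) 𝓘(ℝ, ℝ) ∞ f) (X : SmoothVectorField d M) :
    SmoothVectorField d M :=
  ⟨f • (X : Π x : M, TangentSpace (𝓡 d) x), hf.smul_section X.contMDiff⟩

@[simp]
lemma coe_smulField (f : M → ℝ) (hf : ContMDiff (𝓡 d) 𝓘(ℝ, ℝ) ∞ f) (X : SmoothVectorField d M) :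
    (smulField f hf X : Π x : M, TangentSpace (𝓡 d) x) =
      f • (X : Π x : M, TangentSpace (𝓡 d) x) := rfl

variable [T2Space M]

/-- A local frame around `p` can be extended to smooth vector fields. -/
lemma exists_smoothVectorField_eq_localFrame (p : M)
    (b : Module.Basis (Fin d) ℝ (EuclideanSpace ℝ (Fin d))) :
    ∃ F : Fin d → SmoothVectorField d M, ∀ i, ∀ᶠ q in nhds p, F i q =
      (trivializationAt (EuclideanSpace ℝ (Fin d))
        (fun x : M => TangentSpace (𝓡 d) x) p).localFrame b i q := by
  let e := trivializationAt (EuclideanSpace ℝ (Fin d)) (fun x : M => TangentSpace (𝓡 d) x) p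
  -- Cutting the local frame off by a bump function keeps it unchanged near `p` and smooth
  -- everywhere.
  obtain ⟨χ⟩ : Nonempty (SmoothBumpFunction (𝓡 d) p) := inferInstance
  have hχ : tsupport χ ⊆ e.baseSet := by
    have h := χ.tsupport_subset_chartAt_source
    rwa [← TangentBundle.trivializationAt_baseSet (I := 𝓡 d)] at h
  refine ⟨fun i => ⟨(χ : M → ℝ) • (e.localFrame b i), ContMDiffOn.smul_section_of_tsupport
    χ.contMDiff.contMDiffOn e.open_baseSet hχ (e.contMDiffOn_localFrame_baseSet ∞ b i)⟩,
    fun i => ?_⟩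
  filter_upwards [χ.eventuallyEq_one] with q hq
  change χ q • e.localFrame b i q = e.localFrame b i q
  rw [hq, Pi.one_apply, one_smul]

/-- Tangent vectors at `p` extend linearly to smooth vector fields. -/
lemma exists_linear_extension (p : M) :
    ∃ ext : TangentSpace (𝓡 d) p →ₗ[ℝ] SmoothVectorField d M, ∀ v, ext v p = v := by
  let b := Module.finBasisOfFinrankEq ℝ (EuclideanSpace ℝ (Fin d)) finrank_euclideanSpace_fin
  obtain ⟨F, hF⟩ := exists_smoothVectorField_eq_localFrame (M := M) p b
  let e := trivializationAt (EuclideanSpace ℝ (Fin d)) (fun x : M => TangentSpace (𝓡 d) x) p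
  have hp : p ∈ e.baseSet := FiberBundle.mem_baseSet_trivializationAt' p
  let B : Module.Basis (Fin d) ℝ (TangentSpace (𝓡 d) p) := e.basisAt b hp
  -- Linearity of the extension makes the curvature of extended fields linear in the vectors at `p`,
  -- with no recourse to tensoriality.
  refine ⟨B.constr ℝ F, fun v => ?_⟩
  have h1 : ∀ i, F i p = B i := fun i => by
    rw [(hF i).self_of_nhds, e.localFrame_apply_of_mem_baseSet b hp]
  have h2 : ∀ s : Fin d → ℝ, (∑ i, s i • F i : SmoothVectorField d M) p = ∑ i, s i • F i p := by
    intro s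
    have h3 := map_sum (ContMDiffSection.coeAddHom (𝓡 d) (EuclideanSpace ℝ (Fin d)) ∞
      (fun x : M => TangentSpace (𝓡 d) x)) (fun i => s i • F i) Finset.univ
    simp only [ContMDiffSection.coeAddHom_apply] at h3
    rw [h3, Finset.sum_apply]
    rfl
  rw [Module.Basis.constr_apply_fintype, h2]
  simp only [h1]
  exact B.sum_equivFun v

end Extension

/-! ### Differentiability of sections tested against vector fields -/

section Gram

variable {d : ℕ} {M : Type*} [TopologicalSpace M] [ChartedSpace (EuclideanSpace ℝ (Fin d)) M]
  [IsManifold (𝓡 d) ∞ M] [RiemannianBundle (fun x : M => TangentSpace (𝓡 d) x)]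
  [IsContMDiffRiemannianBundle (𝓡 d) ∞ (EuclideanSpace ℝ (Fin d))
    (fun x : M => TangentSpace (𝓡 d) x)]

/-- The linear map on coordinate vectors given by a matrix of coefficients. -/
def coeffMap {d : ℕ} (G : Fin d → Fin d → ℝ) : (Fin d → ℝ) →L[ℝ] (Fin d → ℝ) :=
  ∑ i, ∑ j, G i j • (ContinuousLinearMap.single ℝ (fun _ : Fin d => ℝ) i).comp
    (ContinuousLinearMap.proj j)

lemma coeffMap_apply {d : ℕ} (G : Fin d → Fin d → ℝ) (c : Fin d → ℝ) (i : Fin d) :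
    coeffMap G c i = ∑ j, G i j * c j := by
  simp [coeffMap, Finset.sum_apply, Pi.single_apply]

lemma mdifferentiableAt_pi {ι G : Type*} [Fintype ι] [NormedAddCommGroup G] [NormedSpace ℝ G]
    {f : M → ι → G} {p : M}
    (hf : ∀ i, MDifferentiableAt (𝓡 d) 𝓘(ℝ, G) (fun q => f q i) p) :
    MDifferentiableAt (𝓡 d) 𝓘(ℝ, ι → G) f p := by
  simp only [mdifferentiableAt_iff] at hf ⊢
  exact ⟨continuousAt_pi.2 fun i => (hf i).1, differentiableWithinAt_pi.2 fun i => (hf i).2⟩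

/-- The solution of a linear system with differentiable coefficients is differentiable. -/
lemma mdifferentiableAt_of_linear_system {p : M} (G : Fin d → Fin d → M → ℝ) (r c : Fin d → M → ℝ)
    (hG : ∀ i j, MDifferentiableAt (𝓡 d) 𝓘(ℝ, ℝ) (G i j) p)
    (hr : ∀ i, MDifferentiableAt (𝓡 d) 𝓘(ℝ, ℝ) (r i) p)
    (hsol : ∀ᶠ q in nhds p, ∀ i, ∑ j, G i j q * c j q = r i q)
    (hinj : ∀ v : Fin d → ℝ, (∀ i, ∑ j, G i j p * v j = 0) → v = 0) (i : Fin d) :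
    MDifferentiableAt (𝓡 d) 𝓘(ℝ, ℝ) (c i) p := by
  let Λ : M → (Fin d → ℝ) →L[ℝ] (Fin d → ℝ) := fun q => coeffMap fun i j => G i j q
  have hΛ : MDifferentiableAt (𝓡 d) 𝓘(ℝ, (Fin d → ℝ) →L[ℝ] (Fin d → ℝ)) Λ p := by
    have h : Differentiable ℝ (coeffMap (d := d)) := by
      unfold coeffMap
      fun_prop
    exact (h _).mdifferentiableAt.comp p
      (mdifferentiableAt_pi fun i => mdifferentiableAt_pi fun j => hG i j)
  have hunit : IsUnit (Λ p) := by
    have hker : Function.Injective (Λ p : (Fin d → ℝ) →ₗ[ℝ] (Fin d → ℝ)) := by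
      rw [← LinearMap.ker_eq_bot, LinearMap.ker_eq_bot']
      intro v hv
      refine hinj v fun i => ?_
      rw [← coeffMap_apply (fun i j => G i j p) v i]
      exact congrFun hv i
    let u := (LinearEquiv.ofInjectiveEndo _ hker).toContinuousLinearEquiv
    exact ⟨ContinuousLinearEquiv.toUnit u, by ext v i; rfl⟩
  have hinv : MDifferentiableAt (𝓡 d) 𝓘(ℝ, (Fin d → ℝ) →L[ℝ] (Fin d → ℝ))
      (fun q => Ring.inverse (Λ q)) p := by
    obtain ⟨u, hu⟩ := hunit
    have h := (differentiableAt_inverse (𝕜 := ℝ) u.isUnit).mdifferentiableAt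
    rw [hu] at h
    exact h.comp p hΛ
  have hr' : MDifferentiableAt (𝓡 d) 𝓘(ℝ, Fin d → ℝ) (fun q i => r i q) p := by
    exact mdifferentiableAt_pi hr
  have hprod : MDifferentiableAt (𝓡 d) 𝓘(ℝ, Fin d → ℝ)
      (fun q => Ring.inverse (Λ q) (fun i => r i q)) p := hinv.clm_apply hr'
  have hprod_i : MDifferentiableAt (𝓡 d) 𝓘(ℝ, ℝ)
      (fun q => Ring.inverse (Λ q) (fun i => r i q) i) p :=
    ((ContinuousLinearMap.proj (R := ℝ) (φ := fun _ : Fin d => ℝ) i).mdifferentiableAt).comp p hprod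
  refine hprod_i.congr_of_eventuallyEq ?_
  -- `Ring.inverse` is zero off the units, so the formula for `c` is used only near `p`, where `Λ`
  -- stays invertible.
  have hunits : ∀ᶠ q in nhds p, IsUnit (Λ q) :=
    hΛ.continuousAt.eventually (Units.isOpen.mem_nhds hunit)
  filter_upwards [hsol, hunits] with q hq hu
  have h1 : Λ q (fun j => c j q) = fun i => r i q := by
    ext i
    rw [← hq i]
    exact coeffMap_apply _ _ _
  rw [← h1]
  exact (congrArg (fun Ψ : (Fin d → ℝ) →L[ℝ] (Fin d → ℝ) => Ψ (fun j => c j q) i)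
    (Ring.inverse_mul_cancel _ hu)).symm

variable [T2Space M]

/-- A vector field whose inner products with smooth vector fields are differentiable at `p` is
differentiable at `p`. -/
lemma diffAt_of_inner {p : M} (W : Π x : M, TangentSpace (𝓡 d) x)
    (hW : ∀ Z : SmoothVectorField d M,
      MDifferentiableAt (𝓡 d) 𝓘(ℝ, ℝ) (fun q => ⟪W q, Z q⟫_ℝ) p) : DiffAt W p := by
  let b := Module.finBasisOfFinrankEq ℝ (EuclideanSpace ℝ (Fin d)) finrank_euclideanSpace_fin
  obtain ⟨F, hF⟩ := exists_smoothVectorField_eq_localFrame (M := M) p b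
  let e := trivializationAt (EuclideanSpace ℝ (Fin d)) (fun x : M => TangentSpace (𝓡 d) x) p
  have hp : p ∈ e.baseSet := FiberBundle.mem_baseSet_trivializationAt' p
  refine (_root_.mdifferentiableAt_iff_localFrameCoeff (e := e) (I := 𝓡 d) (b := b) hp).2 fun i => ?_
  -- The frame coefficients of `W` solve the linear system whose matrix is the Gram matrix of the
  -- frame.
  refine mdifferentiableAt_of_linear_system (fun i j q => ⟪F j q, F i q⟫_ℝ)
    (fun i q => ⟪W q, F i q⟫_ℝ) (fun j q => e.localFrameCoeff (𝓡 d) b j q (W q))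
    (fun i j => MDifferentiableAt.inner_bundle ((F j).diffAt p) ((F i).diffAt p))
    (fun i => hW (F i)) ?_ ?_ i
  · filter_upwards [Trivialization.eventually_eq_localFrame_sum_coeff_smul (e := e) (I := 𝓡 d)
        (s := W) b hp,
      Filter.eventually_all.2 hF] with q h1 h2 i
    conv_rhs => rw [h1]
    rw [sum_inner]
    refine Finset.sum_congr rfl fun j _ => ?_
    rw [inner_smul_left, h2 j, RCLike.conj_to_real, mul_comm]
  · intro v hv
    have h1 : ∀ i, F i p = e.basisAt b hp i := fun i => by
      rw [(hF i).self_of_nhds, e.localFrame_apply_of_mem_baseSet b hp]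
    have h2 : ∑ j, v j • F j p = 0 := by
      have h3 : ∀ i, ⟪∑ j, v j • F j p, F i p⟫_ℝ = 0 := by
        intro i
        rw [← hv i, sum_inner]
        exact Finset.sum_congr rfl fun j _ => by
          rw [inner_smul_left, RCLike.conj_to_real, mul_comm]
      rw [← inner_self_eq_zero (𝕜 := ℝ)]
      rw [inner_sum]
      refine Finset.sum_eq_zero fun i _ => ?_
      rw [inner_smul_right, h3, mul_zero]
    simp only [h1] at h2
    exact funext (Fintype.linearIndependent_iff.1 (e.basisAt b hp).linearIndependent v h2)

end Gram

/-! ### Curvature of the Levi-Civita connection -/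

section LeviCivita

variable {d : ℕ} {M : Type*} [TopologicalSpace M] [ChartedSpace (EuclideanSpace ℝ (Fin d)) M]
  [IsManifold (𝓡 d) ∞ M] [RiemannianBundle (fun x : M => TangentSpace (𝓡 d) x)]
  [IsContMDiffRiemannianBundle (𝓡 d) ∞ (EuclideanSpace ℝ (Fin d))
    (fun x : M => TangentSpace (𝓡 d) x)]

lemma contMDiff_inner (X Y : SmoothVectorField d M) :
    ContMDiff (𝓡 d) 𝓘(ℝ, ℝ) ∞ (fun q => ⟪X q, Y q⟫_ℝ) :=
  ContMDiff.inner_bundle X.contMDiff Y.contMDiff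

lemma mdifferentiableAt_inner {X Y : Π x : M, TangentSpace (𝓡 d) x} {p : M} (hX : DiffAt X p)
    (hY : DiffAt Y p) : MDifferentiableAt (𝓡 d) 𝓘(ℝ, ℝ) (fun q => ⟪X q, Y q⟫_ℝ) p :=
  MDifferentiableAt.inner_bundle hX hY

lemma DiffAt.sub {X Y : Π x : M, TangentSpace (𝓡 d) x} {p : M} (hX : DiffAt X p)
    (hY : DiffAt Y p) : DiffAt (fun q => X q - Y q) p :=
  mdifferentiableAt_sub_section hX hY

lemma DiffAt.smul {f : M → ℝ} {X : Π x : M, TangentSpace (𝓡 d) x} {p : M}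
    (hf : MDifferentiableAt (𝓡 d) 𝓘(ℝ, ℝ) f p) (hX : DiffAt X p) :
    DiffAt (fun q => f q • X q) p :=
  MDifferentiableAt.smul_section hf hX

/-- The Jacobi identity for smooth vector fields. -/
lemma mlieBracket_jacobi (X Y Z : SmoothVectorField d M) (p : M) :
    mlieBracket (𝓡 d) X (mlieBracket (𝓡 d) Y Z) p =
      mlieBracket (𝓡 d) (mlieBracket (𝓡 d) X Y) Z p +
        mlieBracket (𝓡 d) Y (mlieBracket (𝓡 d) X Z) p := by
  have : IsManifold (𝓡 d) (minSmoothness ℝ 3) M := by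
    rw [minSmoothness_of_isRCLikeNormedField]; infer_instance
  have hsm : ∀ Z : SmoothVectorField d M, ContMDiffAt (𝓡 d)
      ((𝓡 d).prod 𝓘(ℝ, EuclideanSpace ℝ (Fin d))) (minSmoothness ℝ 2)
      (fun x => TotalSpace.mk' (EuclideanSpace ℝ (Fin d)) x (Z x)) p := fun Z => by
    rw [minSmoothness_of_isRCLikeNormedField]
    exact (Z.contMDiff p).of_le ENat.LEInfty.out
  exact leibniz_identity_mlieBracket_apply (hsm X) (hsm Y) (hsm Z)

/-- The derivative of a smooth function along a smooth vector field is differentiable. -/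
lemma mdifferentiableAt_mvfderiv_apply (N : SmoothVectorField d M) (hN : ∀ q, ⟪N q, N q⟫_ℝ = 1)
    {f : M → ℝ} (hf : ContMDiff (𝓡 d) 𝓘(ℝ, ℝ) ∞ f) (X : SmoothVectorField d M) (p : M) :
    MDifferentiableAt (𝓡 d) 𝓘(ℝ, ℝ) (fun q => mvfderiv (𝓡 d) f q (X q)) p := by
  have hfd := hf.mdifferentiable (by simp)
  -- `[X, fN] = X(f) N + f [X, N]`; pairing with the unit field `N` isolates `X(f)`, and the
  -- brackets are smooth.
  have h : (fun q => mvfderiv (𝓡 d) f q (X q)) = fun q =>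
      ⟪lieBracketField X (smulField f hf N) q - f q • lieBracketField X N q, N q⟫_ℝ := by
    funext q
    rw [lieBracketField_apply, coe_smulField, mlieBracket_smul_right (hfd q) (N.diffAt q),
      lieBracketField_apply, add_sub_cancel_right, inner_smul_left, hN, mul_one]
    rfl
  rw [h]
  exact mdifferentiableAt_inner (DiffAt.sub (SmoothVectorField.diffAt _ p)
    (DiffAt.smul (hfd p) (SmoothVectorField.diffAt _ p))) (N.diffAt p)

/-- The Lie bracket acts on functions as the commutator of derivations. -/
lemma mvfderiv_mlieBracket (N : SmoothVectorField d M) (hN : ∀ q, ⟪N q, N q⟫_ℝ = 1)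
    {f : M → ℝ} (hf : ContMDiff (𝓡 d) 𝓘(ℝ, ℝ) ∞ f) (X Y : SmoothVectorField d M) (p : M) :
    mvfderiv (𝓡 d) f p (mlieBracket (𝓡 d) X Y p) =
      mvfderiv (𝓡 d) (fun q => mvfderiv (𝓡 d) f q (Y q)) p (X p) -
        mvfderiv (𝓡 d) (fun q => mvfderiv (𝓡 d) f q (X q)) p (Y p) := by
  have hfd := hf.mdifferentiable (by simp)
  have hbr : ∀ V W : SmoothVectorField d M,
      mlieBracket (𝓡 d) V (f • (W : Π x, TangentSpace (𝓡 d) x)) =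
      (fun q => mvfderiv (𝓡 d) f q (V q)) • (W : Π x, TangentSpace (𝓡 d) x) +
        f • (lieBracketField V W : Π x, TangentSpace (𝓡 d) x) := by
    intro V W
    funext q
    exact mlieBracket_smul_right (hfd q) (W.diffAt q)
  have hbr2 : ∀ (V W : SmoothVectorField d M), mlieBracket (𝓡 d) V
        (mlieBracket (𝓡 d) W (f • (N : Π x, TangentSpace (𝓡 d) x))) p =
      mvfderiv (𝓡 d) (fun q => mvfderiv (𝓡 d) f q (W q)) p (V p) • N p +
      mvfderiv (𝓡 d) f p (W p) • mlieBracket (𝓡 d) V N p +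
      (mvfderiv (𝓡 d) f p (V p) • mlieBracket (𝓡 d) W N p +
        f p • mlieBracket (𝓡 d) V (mlieBracket (𝓡 d) W N) p) := by
    intro V W
    have hD := mdifferentiableAt_mvfderiv_apply N hN hf W p
    have h1 : DiffAt ((fun q => mvfderiv (𝓡 d) f q (W q)) • (N : Π x, TangentSpace (𝓡 d) x)) p :=
      DiffAt.smul hD (N.diffAt p)
    have h2 : DiffAt (f • (lieBracketField W N : Π x, TangentSpace (𝓡 d) x)) p :=
      DiffAt.smul (hfd p) (SmoothVectorField.diffAt _ p)
    rw [hbr, mlieBracket_add_right h1 h2,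
      mlieBracket_smul_right hD (N.diffAt p),
      mlieBracket_smul_right (hfd p) (SmoothVectorField.diffAt _ p)]
    rfl
  -- Jacobi for `X, Y, fN` minus `f` times Jacobi for `X, Y, N` leaves the commutator identity
  -- multiplied by `N`.
  have hJ := mlieBracket_jacobi X Y (smulField f hf N) p
  have hJN := mlieBracket_jacobi X Y N p
  have h3 := congrFun (hbr (lieBracketField X Y) N) p
  rw [coe_smulField, hbr2, hbr2] at hJ
  have h4 : mlieBracket (𝓡 d) (mlieBracket (𝓡 d) X Y) (f • (N : Π x, TangentSpace (𝓡 d) x)) p =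
    mvfderiv (𝓡 d) f p (mlieBracket (𝓡 d) X Y p) • N p +
      f p • mlieBracket (𝓡 d) (mlieBracket (𝓡 d) X Y) N p := h3
  rw [h4, hJN] at hJ
  have h5 : (mvfderiv (𝓡 d) (fun q => mvfderiv (𝓡 d) f q (Y q)) p (X p) -
        mvfderiv (𝓡 d) (fun q => mvfderiv (𝓡 d) f q (X q)) p (Y p) -
        mvfderiv (𝓡 d) f p (mlieBracket (𝓡 d) X Y p)) • N p = 0 := by
    linear_combination (norm := module) hJ
  have h6 := congrArg (fun v => ⟪v, N p⟫_ℝ) h5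
  simp only [inner_smul_left, hN, inner_zero_left, RCLike.conj_to_real, mul_one] at h6
  linarith

variable {nabla : CovariantDerivative (𝓡 d) (EuclideanSpace ℝ (Fin d))
    (fun x : M => TangentSpace (𝓡 d) x)}

lemma IsLeviCivita.torsion_free (h : IsLeviCivita nabla) {X Y : Π x : M, TangentSpace (𝓡 d) x}
    {p : M} (hX : DiffAt X p) (hY : DiffAt Y p) :
    nabla Y p (X p) - nabla X p (Y p) = mlieBracket (𝓡 d) X Y p :=
  nabla.torsion_eq_zero_iff.1 h.1 hX hY

lemma IsLeviCivita.metric (h : IsLeviCivita nabla) {Y Z : Π x : M, TangentSpace (𝓡 d) x}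
    {p : M} (X : Π x : M, TangentSpace (𝓡 d) x) (hY : DiffAt Y p) (hZ : DiffAt Z p) :
    mvfderiv (𝓡 d) (fun q => ⟪Y q, Z q⟫_ℝ) p (X p) =
      ⟪nabla Y p (X p), Z p⟫_ℝ + ⟪Y p, nabla Z p (X p)⟫_ℝ :=
  h.2.mvfderiv_inner_eq X hY hZ

/-- The Koszul formula. -/
lemma IsLeviCivita.koszul (h : IsLeviCivita nabla) (X Y Z : SmoothVectorField d M) (p : M) :
    2 * ⟪nabla Y p (X p), Z p⟫_ℝ =
      mvfderiv (𝓡 d) (fun q => ⟪Y q, Z q⟫_ℝ) p (X p) +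
      mvfderiv (𝓡 d) (fun q => ⟪X q, Z q⟫_ℝ) p (Y p) -
      mvfderiv (𝓡 d) (fun q => ⟪X q, Y q⟫_ℝ) p (Z p) +
      ⟪lieBracketField X Y p, Z p⟫_ℝ - ⟪lieBracketField X Z p, Y p⟫_ℝ -
      ⟪lieBracketField Y Z p, X p⟫_ℝ := by
  have hX := X.diffAt p
  have hY := Y.diffAt p
  have hZ := Z.diffAt p
  simp only [lieBracketField_apply]
  rw [h.metric X hY hZ, h.metric Y hX hZ, h.metric Z hX hY, ← h.torsion_free hX hY,
    ← h.torsion_free hX hZ, ← h.torsion_free hY hZ]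
  simp only [inner_sub_left]
  rw [real_inner_comm (Y p) (nabla Z p (X p)), real_inner_comm (X p) (nabla Z p (Y p)),
    real_inner_comm (X p) (nabla Y p (Z p))]
  ring

variable [T2Space M]

/-- The Levi-Civita derivative of a smooth vector field along a smooth vector field is
differentiable. -/
lemma IsLeviCivita.diffAt_nabla (h : IsLeviCivita nabla) (N : SmoothVectorField d M)
    (hN : ∀ q, ⟪N q, N q⟫_ℝ = 1) (X Y : SmoothVectorField d M) (p : M) :
    DiffAt (fun q => nabla Y q (X q)) p := by
  refine diffAt_of_inner _ fun Z => ?_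
  have hD : ∀ U V W : SmoothVectorField d M, MDifferentiableAt (𝓡 d) 𝓘(ℝ, ℝ)
      (fun q => mvfderiv (𝓡 d) (fun q => ⟪U q, V q⟫_ℝ) q (W q)) p := fun U V W =>
    mdifferentiableAt_mvfderiv_apply N hN (contMDiff_inner U V) W p
  have hI : ∀ U V : SmoothVectorField d M, MDifferentiableAt (𝓡 d) 𝓘(ℝ, ℝ)
      (fun q => ⟪U q, V q⟫_ℝ) p := fun U V => mdifferentiableAt_inner (U.diffAt p) (V.diffAt p)
  have hK : (fun q => ⟪nabla Y q (X q), Z q⟫_ℝ) = fun q => (1 / 2 : ℝ) *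
      (mvfderiv (𝓡 d) (fun q => ⟪Y q, Z q⟫_ℝ) q (X q) +
      mvfderiv (𝓡 d) (fun q => ⟪X q, Z q⟫_ℝ) q (Y q) -
      mvfderiv (𝓡 d) (fun q => ⟪X q, Y q⟫_ℝ) q (Z q) +
      ⟪lieBracketField X Y q, Z q⟫_ℝ - ⟪lieBracketField X Z q, Y q⟫_ℝ -
      ⟪lieBracketField Y Z q, X q⟫_ℝ) := by
    funext q
    rw [← h.koszul]
    ring
  rw [hK]
  exact mdifferentiableAt_const.mul
    ((((((hD Y Z X).add (hD X Z Y)).sub (hD X Y Z)).add (hI _ _)).sub (hI _ _)).sub (hI _ _))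

lemma curvature_swap (X Y Z : SmoothVectorField d M) (p : M) :
    curvature nabla X Y Z p = - curvature nabla Y X Z p := by
  simp only [curvature]
  rw [mlieBracket_swap_apply, map_neg]
  abel

/-- The curvature is skew-adjoint. -/
lemma IsLeviCivita.inner_curvature_swap (h : IsLeviCivita nabla) (N : SmoothVectorField d M)
    (hN : ∀ q, ⟪N q, N q⟫_ℝ = 1) (X Y Z W : SmoothVectorField d M) (p : M) :
    ⟪curvature nabla X Y Z p, W p⟫_ℝ = - ⟪curvature nabla X Y W p, Z p⟫_ℝ := by
  -- Second derivatives of `⟪Z, W⟫`. The mixed terms are symmetric in `U, V` and cancel in the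
  -- commutator.
  have h1 : ∀ U V : SmoothVectorField d M,
      mvfderiv (𝓡 d) (fun q => mvfderiv (𝓡 d) (fun q => ⟪Z q, W q⟫_ℝ) q (V q)) p (U p) =
      ⟪nabla (fun q => nabla Z q (V q)) p (U p), W p⟫_ℝ +
        ⟪nabla Z p (V p), nabla W p (U p)⟫_ℝ +
      (⟪nabla Z p (U p), nabla W p (V p)⟫_ℝ +
        ⟪Z p, nabla (fun q => nabla W q (V q)) p (U p)⟫_ℝ) := by
    intro U V
    have hZV := h.diffAt_nabla N hN V Z p
    have hWV := h.diffAt_nabla N hN V W p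
    have e : (fun q => mvfderiv (𝓡 d) (fun q => ⟪Z q, W q⟫_ℝ) q (V q)) =
        fun q => ⟪nabla Z q (V q), W q⟫_ℝ + ⟪Z q, nabla W q (V q)⟫_ℝ :=
      funext fun q => h.metric V (Z.diffAt q) (W.diffAt q)
    rw [e, mvfderiv_fun_add (mdifferentiableAt_inner hZV (W.diffAt p))
      (mdifferentiableAt_inner (Z.diffAt p) hWV)]
    rw [_root_.add_apply, h.metric U hZV (W.diffAt p), h.metric U (Z.diffAt p) hWV]
  have h2 := mvfderiv_mlieBracket N hN (contMDiff_inner Z W) X Y p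
  rw [h1, h1, ← lieBracketField_apply,
    h.metric (lieBracketField X Y) (Z.diffAt p) (W.diffAt p)] at h2
  simp only [lieBracketField_apply] at h2
  simp only [curvature, inner_sub_left]
  rw [real_inner_comm (Z p), real_inner_comm (Z p), real_inner_comm (Z p)]
  linarith

/-- The first Bianchi identity. -/
lemma IsLeviCivita.bianchi (h : IsLeviCivita nabla) (N : SmoothVectorField d M)
    (hN : ∀ q, ⟪N q, N q⟫_ℝ = 1) (X Y Z : SmoothVectorField d M) (p : M) :
    curvature nabla X Y Z p + curvature nabla Y Z X p + curvature nabla Z X Y p = 0 := by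
  -- Vanishing torsion, used twice, turns each group of terms into a double bracket, so the cyclic
  -- sum is the Jacobi identity.
  have h1 : ∀ U V W : SmoothVectorField d M,
      nabla (fun q => nabla W q (V q)) p (U p) - nabla (fun q => nabla V q (W q)) p (U p) -
        nabla U p (mlieBracket (𝓡 d) V W p) =
      mlieBracket (𝓡 d) U (mlieBracket (𝓡 d) V W) p := by
    intro U V W
    have e : (fun q => nabla W q (V q)) =
        (lieBracketField V W : Π x, TangentSpace (𝓡 d) x) + fun q => nabla V q (W q) := by
      funext q
      have := h.torsion_free (V.diffAt q) (W.diffAt q)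
      rw [Pi.add_apply, lieBracketField_apply, ← this, sub_add_cancel]
    rw [e, nabla.isCovariantDerivativeOn.add (SmoothVectorField.diffAt _ p)
      (h.diffAt_nabla N hN W V p)]
    have := h.torsion_free (U.diffAt p) ((lieBracketField V W).diffAt p)
    rw [lieBracketField_apply] at this
    rw [_root_.add_apply, add_sub_cancel_right]
    exact this
  have hJ := mlieBracket_jacobi X Y Z p
  have a1 := h1 X Y Z
  have a2 := h1 Y Z X
  have a3 := h1 Z X Y
  have s1 : mlieBracket (𝓡 d) (mlieBracket (𝓡 d) X Y) Z p =
    - mlieBracket (𝓡 d) Z (mlieBracket (𝓡 d) X Y) p := mlieBracket_swap_apply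
  have s2 : mlieBracket (𝓡 d) Y (mlieBracket (𝓡 d) X Z) p =
      - mlieBracket (𝓡 d) Y (mlieBracket (𝓡 d) Z X) p := by
    have e : mlieBracket (𝓡 d) X Z = (-1 : ℝ) • mlieBracket (𝓡 d) Z X := by
      rw [mlieBracket_swap, neg_one_smul]
    rw [e, mlieBracket_const_smul_right (W := mlieBracket (𝓡 d) Z X)
      ((lieBracketField Z X).diffAt p), neg_one_smul]
  rw [s1, s2] at hJ
  simp only [curvature]
  linear_combination (norm := module) a1 + a2 + a3 + hJ

end LeviCivita

/-! ### Almost contact metric structures of class `C₉ ⊕ C₁₀` -/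

section TrilinearForms

variable {V : Type*} [AddCommGroup V] [Module ℝ V] {φ : V →ₗ[ℝ] V} {ξ : V} {η : V →ₗ[ℝ] ℝ}

/-- The defining symmetries of the sum `𝒞₉ + 𝒞₁₀`. -/
lemma apply_of_mem_classC9_sup_classC10 (hξ : η ξ = 1) (hφξ : φ ξ = 0)
    {a : V →ₗ[ℝ] V →ₗ[ℝ] V →ₗ[ℝ] ℝ} (ha : a ∈ classC9 φ ξ η ⊔ classC10 φ ξ η) :
    (∀ x y z, a x y z = - a x z y) ∧
    ∀ x y z, a x y z = η z * a x y ξ + η y * a (φ x) (φ z) ξ := by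
  obtain ⟨b, hb, c, hc, rfl⟩ := Submodule.mem_sup.1 ha
  -- At `z = ξ` the two classes say that `a(·, ·, ξ)` is symmetric, respectively skew. Swapping its
  -- arguments accordingly merges both defining formulas into one.
  have hb1 : ∀ x y, b x y ξ = b y x ξ := fun x y => by
    have h := hb.2 x y ξ
    simpa [hξ, hφξ] using h
  have hc1 : ∀ x y, c x y ξ = - c y x ξ := fun x y => by
    have h := hc.2 x y ξ
    simpa [hξ, hφξ] using h
  simp only [LinearMap.add_apply]
  refine ⟨fun x y z => ?_, fun x y z => ?_⟩
  · linarith [(hb.1 x y z).1, (hc.1 x y z).1]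
  · rw [hb.2 x y z, hc.2 x y z, hb1 x y, hc1 x y]
    ring

end TrilinearForms

section AlmostContact

variable {d : ℕ} {M : Type*} [TopologicalSpace M] [ChartedSpace (EuclideanSpace ℝ (Fin d)) M]
  [IsManifold (𝓡 d) ∞ M] [RiemannianBundle (fun x : M => TangentSpace (𝓡 d) x)]

namespace IsAlmostContactMetric

variable {φ : SmoothEndomorphismField d M} {ξ : SmoothVectorField d M} {η : SmoothOneForm d M}

/-- From `φ²ξ = 0`, the formula for `φ²` at `φξ` shows that `φξ` is a multiple of `ξ`; applying `φ`
once more makes the multiple zero. -/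
lemma phi_xi (h : IsAlmostContactMetric φ ξ η) (p : M) : φ p (ξ p) = 0 := by
  have h1 : φ p (φ p (ξ p)) = 0 := by
    rw [h.phi_sq, h.eta_xi, one_smul, neg_add_cancel]
  have h2 := h.phi_sq p (φ p (ξ p))
  rw [h1, map_zero] at h2
  have h3 : φ p (ξ p) = η.at p (φ p (ξ p)) • ξ p := by
    rw [← sub_eq_zero, ← neg_eq_zero, neg_sub, sub_eq_neg_add]
    exact h2.symm
  have h4 := congrArg (φ p) h3
  rw [h1, map_smul] at h4
  rcases smul_eq_zero.1 h4.symm with h5 | h5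
  · rw [h3, h5, zero_smul]
  · exact h5

lemma eta_apply (h : IsAlmostContactMetric φ ξ η) (p : M) (v : TangentSpace (𝓡 d) p) :
    η.at p v = ⟪ξ p, v⟫_ℝ := by
  have h1 := h.metric p (ξ p) v
  rw [h.phi_xi, inner_zero_left, h.eta_xi, one_mul] at h1
  linarith

lemma eta_phi (h : IsAlmostContactMetric φ ξ η) (p : M) (v : TangentSpace (𝓡 d) p) :
    η.at p (φ p v) = 0 := by
  have h1 := congrArg (φ p) (h.phi_sq p v)
  rw [map_add, map_neg, map_smul, h.phi_xi, smul_zero, add_zero, h.phi_sq, add_eq_left] at h1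
  have h2 := congrArg (η.at p) h1
  rw [map_smul, h.eta_xi, map_zero, smul_eq_mul, mul_one] at h2
  exact h2

lemma inner_phi_left (h : IsAlmostContactMetric φ ξ η) (p : M) (v w : TangentSpace (𝓡 d) p) :
    ⟪φ p v, w⟫_ℝ = - ⟪v, φ p w⟫_ℝ := by
  have h1 := h.metric p v (φ p w)
  rw [h.phi_sq, h.eta_phi, mul_zero, sub_zero, inner_add_right, inner_neg_right,
    inner_smul_right, real_inner_comm (ξ p), ← h.eta_apply, h.eta_phi, mul_zero, add_zero] at h1
  linarith

lemma inner_xi_xi (h : IsAlmostContactMetric φ ξ η) (p : M) : ⟪ξ p, ξ p⟫_ℝ = 1 := by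
  rw [← h.eta_apply, h.eta_xi]

end IsAlmostContactMetric

/-- The image of a smooth vector field under a smooth endomorphism field. -/
def endoField (φ : SmoothEndomorphismField d M) (X : SmoothVectorField d M) :
    SmoothVectorField d M :=
  ⟨fun q => φ q (X q), ContMDiff.clm_bundle_apply (b := fun x : M => x) φ.contMDiff X.contMDiff⟩

@[simp]
lemma endoField_apply (φ : SmoothEndomorphismField d M) (X : SmoothVectorField d M) (q : M) :
    endoField φ X q = φ q (X q) := rfl

variable [IsContMDiffRiemannianBundle (𝓡 d) ∞ (EuclideanSpace ℝ (Fin d))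
    (fun x : M => TangentSpace (𝓡 d) x)] [T2Space M]

variable {nabla : CovariantDerivative (𝓡 d) (EuclideanSpace ℝ (Fin d))
    (fun x : M => TangentSpace (𝓡 d) x)}
  {φ : SmoothEndomorphismField d M} {ξ : SmoothVectorField d M} {η : SmoothOneForm d M}

lemma IsLeviCivita.metric_apply (h : IsLeviCivita nabla) {Y Z : Π x : M, TangentSpace (𝓡 d) x}
    {p : M} (v : TangentSpace (𝓡 d) p) (hY : DiffAt Y p) (hZ : DiffAt Z p) :
    mvfderiv (𝓡 d) (fun q => ⟪Y q, Z q⟫_ℝ) p v =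
      ⟪nabla Y p v, Z p⟫_ℝ + ⟪Y p, nabla Z p v⟫_ℝ := by
  obtain ⟨ext, hext⟩ := exists_linear_extension (d := d) (M := M) p
  have := h.metric (ext v) hY hZ
  rwa [hext] at this

/-- By metric compatibility, `∇Φ` is the metric dual of `∇φ`. This converts the class condition into
a formula for `∇φ`. -/
lemma nablaPhi_apply_inner (hLC : IsLeviCivita nabla) {p : M} (x y : TangentSpace (𝓡 d) p)
    {Z : Π x : M, TangentSpace (𝓡 d) x} (hZ : DiffAt Z p) :
    nablaPhi nabla φ p x y (Z p) =
      ⟪y, nabla (fun q => φ q (Z q)) p x - φ p (nabla Z p x)⟫_ℝ := by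
  obtain ⟨ext, hext⟩ := exists_linear_extension (d := d) (M := M) p
  have h1 := nablaPhi_apply nabla φ (ext x) ((ext y).diffAt p) hZ
  rw [hext, hext] at h1
  have h2 := hLC.metric_apply x ((ext y).diffAt p) (diffAt_endomorphism_apply φ hZ)
  rw [hext] at h2
  rw [h1]
  simp only [fundamentalForm]
  rw [h2, inner_sub_right]
  ring

/-! ### First and second covariant derivatives in the class -/

section ClassC9C10

/-- Differentiate `⟪ξ, ξ⟫ = 1`. Hence `∇ξ` takes values in `ker η`. -/
lemma eta_nabla_xi (hLC : IsLeviCivita nabla) (hφ : IsAlmostContactMetric φ ξ η) (p : M)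
    (x : TangentSpace (𝓡 d) p) : η.at p (nabla ξ p x) = 0 := by
  have h1 := hLC.metric_apply x (ξ.diffAt p) (ξ.diffAt p)
  simp only [hφ.inner_xi_xi, mvfderiv_const] at h1
  rw [real_inner_comm (ξ p)] at h1
  rw [hφ.eta_apply]
  have h2 : (0 : ℝ) = ⟪ξ p, nabla ξ p x⟫_ℝ + ⟪ξ p, nabla ξ p x⟫_ℝ := h1
  linarith

lemma nablaPhi_xi (hLC : IsLeviCivita nabla) (hφ : IsAlmostContactMetric φ ξ η) (p : M)
    (x y : TangentSpace (𝓡 d) p) :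
    nablaPhi nabla φ p x y (ξ p) = - ⟪y, φ p (nabla ξ p x)⟫_ℝ := by
  have h1 := nablaPhi_apply_inner (φ := φ) hLC x y (ξ.diffAt p)
  have h2 : (fun q => φ q (ξ q)) = (0 : Π q : M, TangentSpace (𝓡 d) q) :=
    funext fun q => hφ.phi_xi q
  rw [h1, h2, nabla.zero, Pi.zero_apply, zero_apply, zero_sub, inner_neg_right]

/-- In class `C₉ ⊕ C₁₀`, `∇ξ` anti-commutes with `φ`. -/
lemma nabla_xi_phi (hLC : IsLeviCivita nabla) (hφ : IsAlmostContactMetric φ ξ η)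
    (hC : IsClassC9C10 nabla φ ξ η) (p : M) (x : TangentSpace (𝓡 d) p) :
    nabla ξ p (φ p x) = - φ p (nabla ξ p x) := by
  obtain ⟨hs, hF⟩ := apply_of_mem_classC9_sup_classC10 (hφ.eta_xi p) (hφ.phi_xi p) (hC p)
  refine ext_inner_left ℝ fun z => ?_
  have h1 := hs x (ξ p) z
  have h2 := hF x (ξ p) z
  have h3 := hs x (ξ p) (ξ p)
  have h4 := nablaPhi_xi hLC hφ p (φ p x) (φ p z)
  have h5 := nablaPhi_xi hLC hφ p x z
  rw [hφ.metric, eta_nabla_xi hLC hφ, mul_zero, sub_zero] at h4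
  have h6 : nablaPhi nabla φ p x (ξ p) (ξ p) = 0 := by linarith
  -- The class formula at `(x, ξ, z)` reads `a(x, ξ, z) = a(φx, φz, ξ)`; skew-symmetry also makes it
  -- `-a(x, z, ξ)`, and both sides are expressed through `∇ξ`.
  have h7 : nablaPhi nabla φ p x (ξ p) z = nablaPhi nabla φ p (φ p x) (φ p z) (ξ p) := by
    rw [h2, h6, mul_zero, zero_add]
    have h8 : (η.at p : TangentSpace (𝓡 d) p →ₗ[ℝ] ℝ) (ξ p) = 1 := hφ.eta_xi p
    rw [h8, one_mul]
    rfl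
  rw [inner_neg_right]
  linarith

/-- Anti-commutation and `φξ = 0` put `∇_ξ ξ` in the kernel of `φ`, while it is orthogonal to `ξ`.
-/
lemma nabla_xi_xi (hLC : IsLeviCivita nabla) (hφ : IsAlmostContactMetric φ ξ η)
    (hC : IsClassC9C10 nabla φ ξ η) (p : M) : nabla ξ p (ξ p) = 0 := by
  have h := nabla_xi_phi hLC hφ hC p (ξ p)
  rw [hφ.phi_xi, map_zero, zero_eq_neg] at h
  have h2 := hφ.phi_sq p (nabla ξ p (ξ p))
  rw [h, map_zero, eta_nabla_xi hLC hφ, zero_smul, add_zero, zero_eq_neg] at h2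
  exact h2

/-- The covariant derivative of `φ` in class `C₉ ⊕ C₁₀`. -/
lemma nabla_phi_apply (hLC : IsLeviCivita nabla) (hφ : IsAlmostContactMetric φ ξ η)
    (hC : IsClassC9C10 nabla φ ξ η) {p : M} (x : TangentSpace (𝓡 d) p)
    {Z : Π x : M, TangentSpace (𝓡 d) x} (hZ : DiffAt Z p) :
    nabla (fun q => φ q (Z q)) p x = φ p (nabla Z p x) - η.at p (Z p) • φ p (nabla ξ p x) -
      ⟪φ p (Z p), nabla ξ p x⟫_ℝ • ξ p := by
  obtain ⟨-, hF⟩ := apply_of_mem_classC9_sup_classC10 (hφ.eta_xi p) (hφ.phi_xi p) (hC p)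
  refine ext_inner_left ℝ fun y => ?_
  have h1 := nablaPhi_apply_inner (φ := φ) hLC x y hZ
  have h2 := hF x y (Z p)
  have h3 : nablaPhi nabla φ p x y (Z p) = η.at p (Z p) * nablaPhi nabla φ p x y (ξ p) +
    η.at p y * nablaPhi nabla φ p (φ p x) (φ p (Z p)) (ξ p) := h2
  rw [nablaPhi_xi hLC hφ, nablaPhi_xi hLC hφ, nabla_xi_phi hLC hφ hC, map_neg, hφ.phi_sq,
    eta_nabla_xi hLC hφ, zero_smul, add_zero, neg_neg] at h3
  rw [inner_sub_right] at h1
  simp only [inner_sub_right, inner_smul_right]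
  rw [real_inner_comm (ξ p) y, ← hφ.eta_apply]
  linarith

/-- The exterior derivative of `η` is twice the skew part of `∇ξ`. -/
lemma extDeriv_eq (hLC : IsLeviCivita nabla) (hφ : IsAlmostContactMetric φ ξ η) (p : M)
    (x y : TangentSpace (𝓡 d) p) :
    η.extDeriv p x y = ⟪nabla ξ p x, y⟫_ℝ - ⟪nabla ξ p y, x⟫_ℝ := by
  obtain ⟨ext, hext⟩ := exists_linear_extension (d := d) (M := M) p
  have h1 := η.extDeriv_apply ((ext x).diffAt p) ((ext y).diffAt p)
  have h2 := hLC.torsion_free ((ext x).diffAt p) ((ext y).diffAt p)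
  have h3 := hLC.metric_apply x (ξ.diffAt p) ((ext y).diffAt p)
  have h4 := hLC.metric_apply y (ξ.diffAt p) ((ext x).diffAt p)
  rw [hext] at h3 h4
  simp only [hφ.eta_apply] at h1
  rw [← h2] at h1
  simp only [hext] at h1
  rw [h1, h3, h4, inner_sub_right]
  ring

/-- The Ricci identity for `φ` on the contact distribution. -/
lemma inner_curvature_phi (hLC : IsLeviCivita nabla) (hφ : IsAlmostContactMetric φ ξ η)
    (hC : IsClassC9C10 nabla φ ξ η) (X Y Z : SmoothVectorField d M) {p : M}
    (hZ : η.at p (Z p) = 0) {w : TangentSpace (𝓡 d) p} (hw : η.at p w = 0) :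
    ⟪curvature nabla X Y (endoField φ Z) p, w⟫_ℝ + ⟪curvature nabla X Y Z p, φ p w⟫_ℝ =
      - (⟪nabla ξ p (Y p), φ p (Z p)⟫_ℝ * ⟪nabla ξ p (X p), w⟫_ℝ
        - ⟪nabla ξ p (X p), φ p (Z p)⟫_ℝ * ⟪nabla ξ p (Y p), w⟫_ℝ
        + ⟪nabla ξ p (Y p), Z p⟫_ℝ * ⟪nabla ξ p (X p), φ p w⟫_ℝ
        - ⟪nabla ξ p (X p), Z p⟫_ℝ * ⟪nabla ξ p (Y p), φ p w⟫_ℝ) := by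
  have hN := hφ.inner_xi_xi
  have hξw : ⟪ξ p, w⟫_ℝ = 0 := by rw [← hφ.eta_apply, hw]
  have second : ∀ U V : SmoothVectorField d M,
      ⟪nabla (fun q => nabla (endoField φ Z) q (V q)) p (U p), w⟫_ℝ =
        - ⟪nabla (fun q => nabla Z q (V q)) p (U p), φ p w⟫_ℝ
        + ⟪ξ p, nabla Z p (V p)⟫_ℝ * ⟪nabla ξ p (U p), φ p w⟫_ℝ
        + (⟪nabla ξ p (U p), Z p⟫_ℝ + ⟪ξ p, nabla Z p (U p)⟫_ℝ) * ⟪nabla ξ p (V p), φ p w⟫_ℝ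
        - ⟪nabla ξ p (V p), φ p (Z p)⟫_ℝ * ⟪nabla ξ p (U p), w⟫_ℝ := by
    intro U V
    have hVZ := hLC.diffAt_nabla ξ hN V Z p
    have hVξ := hLC.diffAt_nabla ξ hN V ξ p
    have hf : MDifferentiableAt (𝓡 d) 𝓘(ℝ, ℝ) (fun q => - ⟪ξ q, Z q⟫_ℝ) p :=
      (mdifferentiableAt_inner (ξ.diffAt p) (Z.diffAt p)).neg
    have hg : MDifferentiableAt (𝓡 d) 𝓘(ℝ, ℝ)
        (fun q => - ⟪endoField φ Z q, nabla ξ q (V q)⟫_ℝ) p :=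
      (mdifferentiableAt_inner (SmoothVectorField.diffAt _ p) hVξ).neg
    have e : (fun q => nabla (endoField φ Z) q (V q)) = (fun q => φ q (nabla Z q (V q))) +
        ((fun q => - ⟪ξ q, Z q⟫_ℝ) • (fun q => φ q (nabla ξ q (V q))) +
        (fun q => - ⟪endoField φ Z q, nabla ξ q (V q)⟫_ℝ) •
          (ξ : Π x : M, TangentSpace (𝓡 d) x)) := by
      funext q
      have h1 := nabla_phi_apply hLC hφ hC (V q) (Z.diffAt q)
      rw [hφ.eta_apply] at h1
      refine Eq.trans h1 ?_
      simp only [Pi.add_apply, Pi.smul_apply', endoField_apply]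
      module
    have d1 : DiffAt (fun q => φ q (nabla Z q (V q))) p := diffAt_endomorphism_apply φ hVZ
    have d2 : DiffAt (fun q => φ q (nabla ξ q (V q))) p := diffAt_endomorphism_apply φ hVξ
    have d3 : DiffAt ((fun q => - ⟪ξ q, Z q⟫_ℝ) • (fun q => φ q (nabla ξ q (V q)))) p :=
      DiffAt.smul hf d2
    have d4 : DiffAt ((fun q => - ⟪endoField φ Z q, nabla ξ q (V q)⟫_ℝ) •
          (ξ : Π x : M, TangentSpace (𝓡 d) x)) p := DiffAt.smul hg (ξ.diffAt p)
    have hcd := nabla.isCovariantDerivativeOn (s := Set.univ)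
    have hmf := hLC.metric U (ξ.diffAt p) (Z.diffAt p)
    have hfd : mvfderiv (𝓡 d) (fun q => - ⟪ξ q, Z q⟫_ℝ) p (U p) =
        - (⟪nabla ξ p (U p), Z p⟫_ℝ + ⟪ξ p, nabla Z p (U p)⟫_ℝ) := by
      rw [← hmf, mvfderiv_fun_neg]
      rfl
    -- `Z` is tangent to the distribution only at `p`, so `η(Z)` drops out itself but its derivative
    -- remains.
    have hξZ : ⟪ξ p, Z p⟫_ℝ = 0 := by rw [← hφ.eta_apply, hZ]
    rw [e, hcd.add d1 (mdifferentiableAt_add_section d3 d4), hcd.add d3 d4, hcd.leibniz d2 hf,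
      hcd.leibniz (ξ.diffAt p) hg]
    simp only [_root_.add_apply, smul_apply, ContinuousLinearMap.smulRight_apply]
    rw [nabla_phi_apply hLC hφ hC (U p) hVZ, hfd]
    simp only [inner_add_left, inner_sub_left, inner_smul_left, RCLike.conj_to_real, hξw, hξZ,
      hφ.inner_phi_left, hφ.eta_apply, endoField_apply]
    rw [real_inner_comm (φ p (Z p)), hφ.inner_phi_left]
    ring
  have hbr : ∀ v : TangentSpace (𝓡 d) p,
      ⟪nabla (endoField φ Z) p v, w⟫_ℝ = - ⟪nabla Z p v, φ p w⟫_ℝ := by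
    intro v
    have h1 : nabla (endoField φ Z) p v = _ := nabla_phi_apply hLC hφ hC v (Z.diffAt p)
    rw [h1, hZ, zero_smul, sub_zero, inner_sub_left, inner_smul_left, hξw, mul_zero, sub_zero,
      hφ.inner_phi_left]
  simp only [curvature, inner_sub_left]
  -- The products of `⟪ξ, ∇Z⟫` with `⟪∇ξ, φ w⟫` are symmetric in the two fields and cancel.
  rw [second, second, hbr]
  ring

end ClassC9C10

end AlmostContact

/-! ### The contact distribution -/

section TangentSpace

variable {d : ℕ} {M : Type*} [TopologicalSpace M] [ChartedSpace (EuclideanSpace ℝ (Fin d)) M]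

instance (p : M) : FiniteDimensional ℝ (TangentSpace (𝓡 d) p) :=
  inferInstanceAs (FiniteDimensional ℝ (EuclideanSpace ℝ (Fin d)))

lemma finrank_tangentSpace (p : M) : Module.finrank ℝ (TangentSpace (𝓡 d) p) = d :=
  finrank_euclideanSpace_fin (𝕜 := ℝ) (n := d)

end TangentSpace

section ContactDistribution

variable {d : ℕ} {M : Type*} [TopologicalSpace M] [ChartedSpace (EuclideanSpace ℝ (Fin d)) M]
  [IsManifold (𝓡 d) ∞ M] [RiemannianBundle (fun x : M => TangentSpace (𝓡 d) x)]
  [IsContMDiffRiemannianBundle (𝓡 d) ∞ (EuclideanSpace ℝ (Fin d))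
    (fun x : M => TangentSpace (𝓡 d) x)]
  {nabla : CovariantDerivative (𝓡 d) (EuclideanSpace ℝ (Fin d))
    (fun x : M => TangentSpace (𝓡 d) x)}
  {φ : SmoothEndomorphismField d M} {ξ : SmoothVectorField d M} {η : SmoothOneForm d M}

/-- The contact distribution `D_p = ker η_p`. -/
abbrev contactDistribution (η : SmoothOneForm d M) (p : M) :
    Submodule ℝ (TangentSpace (𝓡 d) p) :=
  LinearMap.ker (η.at p : TangentSpace (𝓡 d) p →ₗ[ℝ] ℝ)

lemma eta_coe_contactDistribution {p : M} (x : contactDistribution η p) : η.at p x = 0 :=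
  x.2

lemma finrank_contactDistribution (hφ : IsAlmostContactMetric φ ξ η) (p : M) :
    Module.finrank ℝ (contactDistribution η p) + 1 = d := by
  refine Eq.trans ?_ (finrank_tangentSpace (d := d) p)
  refine Module.Dual.finrank_ker_add_one_of_ne_zero
    (f := (η.at p : TangentSpace (𝓡 d) p →ₗ[ℝ] ℝ)) fun h0 => ?_
  have h1 := hφ.eta_xi p
  rw [show η.at p (ξ p) = 0 from congrArg (fun L => L (ξ p)) h0] at h1
  exact zero_ne_one h1

/-- The complex structure induced by `φ` on the contact distribution. -/
def contactComplexStructure (hφ : IsAlmostContactMetric φ ξ η) (p : M) :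
    contactDistribution η p →ₗ[ℝ] contactDistribution η p :=
  (φ p : TangentSpace (𝓡 d) p →ₗ[ℝ] TangentSpace (𝓡 d) p).restrict fun x _ => hφ.eta_phi p x

@[simp]
lemma coe_contactComplexStructure (hφ : IsAlmostContactMetric φ ξ η) (p : M)
    (x : contactDistribution η p) :
    (contactComplexStructure hφ p x : TangentSpace (𝓡 d) p) = φ p x := rfl

lemma contactComplexStructure_sq (hφ : IsAlmostContactMetric φ ξ η) (p : M)
    (x : contactDistribution η p) :
    contactComplexStructure hφ p (contactComplexStructure hφ p x) = - x := by
  apply Subtype.ext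
  rw [coe_contactComplexStructure, coe_contactComplexStructure, hφ.phi_sq,
    eta_coe_contactDistribution, zero_smul, add_zero]
  rfl

lemma inner_contactComplexStructure (hφ : IsAlmostContactMetric φ ξ η) (p : M)
    (x y : contactDistribution η p) :
    ⟪contactComplexStructure hφ p x, y⟫_ℝ = - ⟪x, contactComplexStructure hφ p y⟫_ℝ :=
  hφ.inner_phi_left p x y

variable [T2Space M]

/-- The endomorphism `∇ξ` of the contact distribution. -/
def contactShape (hLC : IsLeviCivita nabla) (hφ : IsAlmostContactMetric φ ξ η) (p : M) :
    contactDistribution η p →ₗ[ℝ] contactDistribution η p :=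
  (nabla ξ p : TangentSpace (𝓡 d) p →ₗ[ℝ] TangentSpace (𝓡 d) p).restrict
    fun x _ => eta_nabla_xi hLC hφ p x

lemma contactShape_complexStructure (hLC : IsLeviCivita nabla)
    (hφ : IsAlmostContactMetric φ ξ η) (hC : IsClassC9C10 nabla φ ξ η) (p : M)
    (x : contactDistribution η p) :
    contactShape hLC hφ p (contactComplexStructure hφ p x) =
      - contactComplexStructure hφ p (contactShape hLC hφ p x) :=
  Subtype.ext (nabla_xi_phi hLC hφ hC p x)

/-- Linearity over `ℝ` in this one slot is enough: the curvature symmetries carry it to the others.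
-/
lemma curvature_add_left (hLC : IsLeviCivita nabla) (N : SmoothVectorField d M)
    (hN : ∀ q, ⟪N q, N q⟫_ℝ = 1) (X X' Y Z : SmoothVectorField d M) (p : M) :
    curvature nabla (X + X' : SmoothVectorField d M) Y Z p =
      curvature nabla X Y Z p + curvature nabla X' Y Z p := by
  have e : (fun q => nabla Z q ((X + X' : SmoothVectorField d M) q)) =
      (fun q => nabla Z q (X q)) + fun q => nabla Z q (X' q) :=
    funext fun q => map_add (nabla Z q) _ _
  have hcd := nabla.isCovariantDerivativeOn (s := Set.univ)
  simp only [curvature]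
  rw [e, hcd.add (hLC.diffAt_nabla N hN X Z p) (hLC.diffAt_nabla N hN X' Z p),
    ContMDiffSection.coe_add, mlieBracket_add_left (X.diffAt p) (X'.diffAt p)]
  simp only [Pi.add_apply, map_add, _root_.add_apply]
  abel

lemma curvature_smul_left (hLC : IsLeviCivita nabla) (N : SmoothVectorField d M)
    (hN : ∀ q, ⟪N q, N q⟫_ℝ = 1) (a : ℝ) (X Y Z : SmoothVectorField d M) (p : M) :
    curvature nabla (a • X : SmoothVectorField d M) Y Z p = a • curvature nabla X Y Z p := by
  have e : (fun q => nabla Z q ((a • X : SmoothVectorField d M) q)) =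
      a • (fun q => nabla Z q (X q)) :=
    funext fun q => map_smul (nabla Z q) _ _
  have hcd := nabla.isCovariantDerivativeOn (s := Set.univ)
  simp only [curvature]
  rw [e, hcd.smul_const a (hLC.diffAt_nabla N hN X Z p),
    ContMDiffSection.coe_smul, mlieBracket_const_smul_left (X.diffAt p)]
  simp only [Pi.smul_apply, map_smul, smul_apply, smul_sub]

/-- Constant sectional curvature on the planes of the contact distribution determines the curvature
on the contact distribution. -/
lemma inner_curvature_of_hasSectionalCurvature (hLC : IsLeviCivita nabla)
    (hφ : IsAlmostContactMetric φ ξ η) {p : M} {c : ℝ}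
    (hsec : ∀ P : Submodule ℝ (TangentSpace (𝓡 d) p), Module.finrank ℝ P = 2 →
      (∀ v ∈ P, η.at p v = 0) → HasSectionalCurvature nabla p P c)
    {ext : TangentSpace (𝓡 d) p →ₗ[ℝ] SmoothVectorField d M} (hext : ∀ v, ext v p = v)
    (x y z w : contactDistribution η p) :
    ⟪curvature nabla (ext x) (ext y) (ext z) p, w⟫_ℝ =
      c * (⟪y, z⟫_ℝ * ⟪x, w⟫_ℝ - ⟪x, z⟫_ℝ * ⟪y, w⟫_ℝ) := by
  have hN := hφ.inner_xi_xi
  refine algebraicCurvature_eq_of_constant (W := contactDistribution η p)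
    (fun x y z w => ⟪curvature nabla (ext x) (ext y) (ext z) p, (w : TangentSpace (𝓡 d) p)⟫_ℝ)
    ?_ ?_ ?_ ?_ ?_ c ?_ x y z w
  · intro x x' y z w
    simp only [Submodule.coe_add, map_add]
    rw [curvature_add_left hLC ξ hN, inner_add_left]
  · intro a x y z w
    simp only [Submodule.coe_smul, map_smul]
    rw [curvature_smul_left hLC ξ hN, inner_smul_left, RCLike.conj_to_real]
  · intro x y z w
    rw [curvature_swap, inner_neg_left]
  · intro x y z w
    have h := hLC.inner_curvature_swap ξ hN (ext x) (ext y) (ext z) (ext w) p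
    rwa [hext, hext] at h
  · intro x y z w
    rw [← inner_add_left, ← inner_add_left, hLC.bianchi ξ hN, inner_zero_left]
  · intro x y hxy
    have hxy' : LinearIndependent ℝ ![(x : TangentSpace (𝓡 d) p), (y : TangentSpace (𝓡 d) p)] :=
      LinearIndependent.pair_iff.2 fun s t h => LinearIndependent.pair_iff.1 hxy s t (Subtype.ext h)
    have hrank : Module.finrank ℝ (Submodule.span ℝ
        {(x : TangentSpace (𝓡 d) p), (y : TangentSpace (𝓡 d) p)}) = 2 := by
      have h := finrank_span_eq_card hxy'
      rwa [Matrix.range_cons_cons_empty, Fintype.card_fin] at h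
    have hP : ∀ v ∈ Submodule.span ℝ
        {(x : TangentSpace (𝓡 d) p), (y : TangentSpace (𝓡 d) p)}, η.at p v = 0 := by
      have h : Submodule.span ℝ {(x : TangentSpace (𝓡 d) p), (y : TangentSpace (𝓡 d) p)} ≤
          contactDistribution η p :=
        Submodule.span_le.2 (by rintro v (rfl | rfl); exacts [x.2, y.2])
      exact fun v hv => h hv
    have h := hsec _ hrank hP (ext x) (ext y) (by rwa [hext, hext]) (by rw [hext, hext])
    simp only [sectionalCurvature, hext] at h
    have hden : ⟪(x : TangentSpace (𝓡 d) p), x⟫_ℝ * ⟪(y : TangentSpace (𝓡 d) p), y⟫_ℝ -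
        ⟪(x : TangentSpace (𝓡 d) p), y⟫_ℝ ^ 2 ≠ 0 :=
      gram_ne_zero_of_linearIndependent hxy'
    rw [div_eq_iff hden] at h
    exact h

/-- The wedge identity for `∇ξ` forced by constant sectional curvature on the contact
distribution. -/
lemma complexWedge_contactShape (hLC : IsLeviCivita nabla)
    (hφ : IsAlmostContactMetric φ ξ η) (hC : IsClassC9C10 nabla φ ξ η) {p : M} {c : ℝ}
    (hsec : ∀ P : Submodule ℝ (TangentSpace (𝓡 d) p), Module.finrank ℝ P = 2 →
      (∀ v ∈ P, η.at p v = 0) → HasSectionalCurvature nabla p P c)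
    (x y z w : contactDistribution η p) :
    complexWedge (contactComplexStructure hφ p) (contactShape hLC hφ p x)
      (contactShape hLC hφ p y) z w =
      - (c * complexWedge (contactComplexStructure hφ p) x y z w) := by
  obtain ⟨ext, hext⟩ := exists_linear_extension (d := d) (M := M) p
  have hN := hφ.inner_xi_xi
  set J := contactComplexStructure hφ p
  have h1 := inner_curvature_phi hLC hφ hC (ext x) (ext y) (ext z) (p := p)
    (by rw [hext]; exact z.2) w.2
  -- The fields `φ (ext z)` and `ext (J z)` agree only at `p`. Skew-adjointness moves them into the
  -- slot where only the value at `p` counts.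
  have h2 : ⟪curvature nabla (ext x) (ext y) (endoField φ (ext z)) p, w⟫_ℝ =
      ⟪curvature nabla (ext x) (ext y) (ext (J z)) p, w⟫_ℝ := by
    have a1 := hLC.inner_curvature_swap ξ hN (ext x) (ext y) (endoField φ (ext z)) (ext w) p
    have a2 := hLC.inner_curvature_swap ξ hN (ext x) (ext y) (ext (J z)) (ext w) p
    rw [hext, endoField_apply, hext] at a1
    rw [hext, hext] at a2
    rw [a1, a2]
    rfl
  have h3 := inner_curvature_of_hasSectionalCurvature hLC hφ hsec hext x y (J z) w
  have h4 : ⟪curvature nabla (ext x) (ext y) (ext z) p, φ p w⟫_ℝ = _ :=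
    inner_curvature_of_hasSectionalCurvature hLC hφ hsec hext x y z (J w)
  rw [h2, h3, h4] at h1
  simp only [hext] at h1
  have h5 : complexWedge J (contactShape hLC hφ p x) (contactShape hLC hφ p y) z w =
      ⟪nabla ξ p y, φ p z⟫_ℝ * ⟪nabla ξ p x, w⟫_ℝ
        - ⟪nabla ξ p x, φ p z⟫_ℝ * ⟪nabla ξ p y, w⟫_ℝ
        + ⟪nabla ξ p y, z⟫_ℝ * ⟪nabla ξ p x, φ p w⟫_ℝ
        - ⟪nabla ξ p x, z⟫_ℝ * ⟪nabla ξ p y, φ p w⟫_ℝ := rfl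
  rw [h5]
  simp only [complexWedge]
  linarith

end ContactDistribution

/-! ### Nondegeneracy of `dη` on the contact distribution -/

section ContactForm

variable {m : ℕ} {M : Type*} [TopologicalSpace M]
  [ChartedSpace (EuclideanSpace ℝ (Fin (2 * m + 1))) M] [IsManifold (𝓡 (2 * m + 1)) ∞ M]

/-- For a contact form, `η` and `dη` have no common kernel. -/
lemma IsContactForm.eq_zero_of_extDeriv {η : SmoothOneForm (2 * m + 1) M} (hη : IsContactForm η)
    {p : M} {x : TangentSpace (𝓡 (2 * m + 1)) p} (hx : η.at p x = 0)
    (hdx : ∀ y, η.extDeriv p x y = 0) (hdx' : ∀ y, η.extDeriv p y x = 0) : x = 0 := by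
  by_contra hne
  obtain ⟨v, hv⟩ := hη p
  refine hv ?_
  have := sum_perm_prod_eq_zero (m := m) (V := TangentSpace (𝓡 (2 * m + 1)) p)
    (finrank_tangentSpace p) (η.at p)
    ((ContinuousLinearMap.coeLM ℝ).comp (η.extDeriv p : _ →ₗ[ℝ] _)) hne hx hdx hdx' v
  rw [contactVolume]
  exact mul_eq_zero_of_right _ this

variable [RiemannianBundle (fun x : M => TangentSpace (𝓡 (2 * m + 1)) x)]
  [IsContMDiffRiemannianBundle (𝓡 (2 * m + 1)) ∞ (EuclideanSpace ℝ (Fin (2 * m + 1)))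
    (fun x : M => TangentSpace (𝓡 (2 * m + 1)) x)] [T2Space M]
  {nabla : CovariantDerivative (𝓡 (2 * m + 1)) (EuclideanSpace ℝ (Fin (2 * m + 1)))
    (fun x : M => TangentSpace (𝓡 (2 * m + 1)) x)}
  {φ : SmoothEndomorphismField (2 * m + 1) M} {ξ : SmoothVectorField (2 * m + 1) M}
  {η : SmoothOneForm (2 * m + 1) M}

/-- The skew part of `∇ξ` is nondegenerate on the contact distribution. -/
lemma IsContactForm.nondegenerate_contactShape (hη : IsContactForm η) (hLC : IsLeviCivita nabla)
    (hφ : IsAlmostContactMetric φ ξ η) (hC : IsClassC9C10 nabla φ ξ η) {p : M}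
    (x : contactDistribution η p)
    (hx : ∀ y, ⟪contactShape hLC hφ p x, y⟫_ℝ - ⟪contactShape hLC hφ p y, x⟫_ℝ = 0) : x = 0 := by
  have h1 : ∀ y, η.extDeriv p x y = 0 := by
    intro y
    rw [extDeriv_eq hLC hφ]
    -- Project `y` to the distribution along `ξ`; the `ξ`-component contributes nothing, because
    -- `∇_x ξ ⟂ ξ` and `∇_ξ ξ = 0`.
    have hy : η.at p (y - η.at p y • ξ p) = 0 := by
      rw [map_sub, map_smul, hφ.eta_xi, smul_eq_mul, mul_one, sub_self]
    have h2 : ⟪nabla ξ p x, y - η.at p y • ξ p⟫_ℝ - ⟪nabla ξ p (y - η.at p y • ξ p), x⟫_ℝ = 0 :=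
      hx ⟨_, hy⟩
    rw [map_sub, map_smul, nabla_xi_xi hLC hφ hC, smul_zero, sub_zero, inner_sub_right,
      inner_smul_right, real_inner_comm (ξ p), ← hφ.eta_apply, eta_nabla_xi hLC hφ, mul_zero,
      sub_zero] at h2
    exact h2
  refine Subtype.ext (hη.eq_zero_of_extDeriv x.2 h1 fun y => ?_)
  have h3 := h1 y
  rw [extDeriv_eq hLC hφ] at h3 ⊢
  linarith

/-- The contact distribution of a contact structure of class `C₉ ⊕ C₁₀` has dimension divisible
by four. -/
lemma IsContactForm.four_dvd_finrank (hη : IsContactForm η) (hLC : IsLeviCivita nabla)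
    (hφ : IsAlmostContactMetric φ ξ η) (hC : IsClassC9C10 nabla φ ξ η) (p : M) :
    4 ∣ Module.finrank ℝ (contactDistribution η p) := by
  let A := contactShape hLC hφ p
  let J := contactComplexStructure hφ p
  refine four_dvd_finrank_of_alternating J (contactComplexStructure_sq hφ p)
    ((innerₗ (contactDistribution η p)).comp A - ((innerₗ (contactDistribution η p)).comp A).flip)
    ?_ ?_ ?_
  · intro x y
    simp
  · intro x y
    have h1 : ∀ x y, ⟪A (J x), J y⟫_ℝ = - ⟪A x, y⟫_ℝ := by
      intro x y
      have e1 : A (J x) = - J (A x) := contactShape_complexStructure hLC hφ hC p x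
      have e2 : J (J y) = -y := contactComplexStructure_sq hφ p y
      have e3 : ⟪J (A x), J y⟫_ℝ = - ⟪A x, J (J y)⟫_ℝ := inner_contactComplexStructure hφ p _ _
      rw [e1, inner_neg_left, e3, e2, inner_neg_right, neg_neg]
    simp [h1]
    ring
  · intro x hx
    exact hη.nondegenerate_contactShape hLC hφ hC x hx

end ContactForm

end ContactGeometry

end

/-! ### Dimension count -/

theorem mainTheorem3 {m : ℕ} (hm : 1 ≤ m) {M : Type*} [TopologicalSpace M] [T2Space M] [Nonempty M]
    [ChartedSpace (EuclideanSpace ℝ (Fin (2 * m + 1))) M]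
    [IsManifold (𝓡 (2 * m + 1)) ∞ M]
    [RiemannianBundle (fun x : M => TangentSpace (𝓡 (2 * m + 1)) x)]
    [IsContMDiffRiemannianBundle (𝓡 (2 * m + 1)) ∞ (EuclideanSpace ℝ (Fin (2 * m + 1)))
      (fun x : M => TangentSpace (𝓡 (2 * m + 1)) x)]
    (nabla : CovariantDerivative (𝓡 (2 * m + 1)) (EuclideanSpace ℝ (Fin (2 * m + 1)))
      (fun x : M => TangentSpace (𝓡 (2 * m + 1)) x))
    (hnabla : ContactGeometry.IsLeviCivita nabla)
    (φ : ContactGeometry.SmoothEndomorphismField (2 * m + 1) M)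
    (ξ : ContactGeometry.SmoothVectorField (2 * m + 1) M)
    (η : ContactGeometry.SmoothOneForm (2 * m + 1) M)
    (hη : ContactGeometry.IsContactForm η)
    (hφ : ContactGeometry.IsAlmostContactMetric φ ξ η)
    (hC : ContactGeometry.IsClassC9C10 nabla φ ξ η) :
    (∃ n : ℕ, 1 ≤ n ∧ 2 * m + 1 = 4 * n + 1) ∧
    ((∃ (p : M) (c : ℝ), ∀ P : Submodule ℝ (TangentSpace (𝓡 (2 * m + 1)) p),
        Module.finrank ℝ P = 2 → (∀ v ∈ P, η.at p v = 0) →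
          ContactGeometry.HasSectionalCurvature nabla p P c) →
      2 * m + 1 = 5) := by
  have hdvd := fun p => hη.four_dvd_finrank hnabla hφ hC p
  have hrank := fun p => ContactGeometry.finrank_contactDistribution hφ p
  constructor
  · obtain ⟨p⟩ := ‹Nonempty M›
    obtain ⟨n, hn⟩ := hdvd p
    have := hrank p
    exact ⟨n, by omega, by omega⟩
  · rintro ⟨p, c, hsec⟩
    have h1 := hdvd p
    have h2 := hrank p
    have hJ := ContactGeometry.contactComplexStructure_sq hφ p
    have hJs := ContactGeometry.inner_contactComplexStructure hφ p
    have hwedge := ContactGeometry.complexWedge_contactShape hnabla hφ hC hsec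
    -- The distribution has dimension `2m`, positive and divisible by 4, hence greater than 2.
    have hc : c = 0 := ContactGeometry.eq_zero_of_complexWedge hJ hJs (by omega) _
      (ContactGeometry.contactShape_complexStructure hnabla hφ hC p) c hwedge
    have h3 := ContactGeometry.finrank_le_four_of_complexWedge hJ hJs
      (ContactGeometry.contactShape hnabla hφ p)
      (fun x y z w => by rw [hwedge, hc, zero_mul, neg_zero])
      (hη.nondegenerate_contactShape hnabla hφ hC)
    omega
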